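/- On $SL(2,\mathbb R)\times SL(2,\mathbb R)$, with tangent vectors at $(A,B)$ written $(A\alpha,B\beta)$ with $\alpha,\beta$ real $2\times2$ matrices of trace $0$, consider the almost complex structure $$J(A\alpha,B\beta)=\tfrac{1}{\sqrt3}\bigl(A(\alpha-2\beta),B(2\alpha-\beta)\bigr)$$ and the pseudo-Riemannian metric $$g\bigl((A\alpha,B\beta),(A\gamma,B\delta)\bigr)=\tfrac23\bigl(\langle\alpha,\gamma\rangle+\langle\beta,\delta\rangle\bigr)-\tfrac13\bigl(\langle\beta,\gamma\rangle+\langle\alpha,\delta\rangle\bigr),$$ where $\langle a,b\rangle=-\tfrac12(a_{11}b_{22}-a_{12}b_{21}-a_{21}b_{12}+a_{22}b_{11})$. Let $M$ be a connected smooth surface and $F:M\to SL(2,\mathbb R)\times SL(2,\mathbb R)$ a smooth immersion which is almost complex (its tangent planes are $J$-invariant), totally geodesic (its second fundamental form with respect to the Levi-Civita connection of $g$ vanishes), flat (the Gaussian curvature of the induced metric is $0$), and whose induced metric is negative definite. Then, up to an isometry of the ambient space, $F$ is locally the immersion $(s,t)\mapsto(A(s,t),B(s,t))$ with $$A(s,t)=\begin{pmatrix}\cos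 u&\sin u\\-\sin u&\cos u\end{pmatrix},\quad B(s,t)=\begin{pmatrix}\cos w&\sin w\\-\sin w&\cos w\end{pmatrix},\quad u=\tfrac{1}{\sqrt2}(\sqrt3\,s-t),\quad w=\tfrac{1}{\sqrt2}(\sqrt3\,s+t).$$ More precisely, there are $a,b,c\in SL(2,\mathbb R)$ such that the map $\Phi(p,q)=(apc,bqc)$ is an isometry of $g$, and every point of $M$ has a neighbourhood with smooth coordinates $(s,t)$ of $M$ in which $\Phi\circ F=(A(s,t),B(s,t))$. -/

import Mathlib

open scoped Manifold ContDiff MatrixGroups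

noncomputable section

namespace NKSL2

/-- Real `2 × 2` matrices. -/
abbrev Mat : Type := Matrix (Fin 2) (Fin 2) ℝ

/-- The manifold `SL(2,ℝ) × SL(2,ℝ)`. It is regarded as an embedded submanifold of the vector space
of pairs of matrices, so smoothness and derivatives of maps into it are those of the matrix
entries. -/
abbrev SLxSL : Type := SL(2, ℝ) × SL(2, ℝ)

/-! ### The nearly Kähler structure

A tangent vector `(Aα, Bβ)` of `SL(2,ℝ) × SL(2,ℝ)` at `(A, B)`, with `α`, `β` of trace zero, is
represented by the pair `(α, β)` (left trivialization). -/

/-- The indefinite inner product `⟨a, b⟩ = -½ (a₁b₄ - a₂b₃ - a₃b₂ + a₄b₁)` on matrices. -/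
def ip (X Y : Mat) : ℝ :=
  -(1 / 2) * (X 0 0 * Y 1 1 - X 0 1 * Y 1 0 - X 1 0 * Y 0 1 + X 1 1 * Y 0 0)

/-- `⟨Aα, Aγ⟩ = ⟨α, γ⟩` for `A ∈ SL(2,ℝ)`: the product is left invariant. -/
theorem ip_mul_left (A : SL(2, ℝ)) (X Y : Mat) : ip (A.1 * X) (A.1 * Y) = ip X Y := by
  have h := A.2
  rw [Matrix.det_fin_two] at h
  have : ip (A.1 * X) (A.1 * Y) = (A.1 0 0 * A.1 1 1 - A.1 0 1 * A.1 1 0) * ip X Y := by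
    simp only [ip, Matrix.mul_apply, Fin.sum_univ_two]
    ring
  rw [this, h, one_mul]

/-- The almost complex structure `J(Aα, Bβ) = (1/√3) (A(α - 2β), B(2α - β))`. -/
def J (x : Mat × Mat) : Mat × Mat :=
  ((1 / √3 : ℝ) • (x.1 - (2 : ℝ) • x.2), (1 / √3 : ℝ) • ((2 : ℝ) • x.1 - x.2))

/-- The pseudo-Riemannian metric
`g((Aα, Bβ), (Aγ, Bδ)) = ⅔ ⟨(Aα, Bβ), (Aγ, Bδ)⟩ - ⅓ ⟨(Aβ, Bα), (Aγ, Bδ)⟩`. -/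
def g (x y : Mat × Mat) : ℝ :=
  2 / 3 * (ip x.1 y.1 + ip x.2 y.2) - 1 / 3 * (ip x.2 y.1 + ip x.1 y.2)

/-- The product `α × β = ½ (αβ - βα)` of trace zero matrices. -/
def cross (X Y : Mat) : Mat := (1 / 2 : ℝ) • (X * Y - Y * X)

/-- The Levi-Civita connection of `g` on left invariant vector fields: `nabla x y` is
`∇_x y`. It is characterized by `nabla_torsion_free` and `nabla_metric`. -/
def nabla (x y : Mat × Mat) : Mat × Mat :=
  (cross x.1 y.1 - (1 / 3 : ℝ) • cross x.1 y.2 + (1 / 3 : ℝ) • cross x.2 y.1,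
   cross x.2 y.2 + (1 / 3 : ℝ) • cross x.1 y.2 - (1 / 3 : ℝ) • cross x.2 y.1)

/-- The connection is torsion free: `∇_x y - ∇_y x = [x, y]`. -/
theorem nabla_torsion_free (x y : Mat × Mat) :
    nabla x y - nabla y x = (x.1 * y.1 - y.1 * x.1, x.2 * y.2 - y.2 * x.2) := by
  ext i j <;> simp [nabla, cross] <;> ring

/-- The connection is metric: `g(∇_x y, z) + g(y, ∇_x z) = 0` for left invariant fields. -/
theorem nabla_metric (x y z : Mat × Mat) (hy₁ : y.1.trace = 0) (hy₂ : y.2.trace = 0)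
    (hz₁ : z.1.trace = 0) (hz₂ : z.2.trace = 0) :
    g (nabla x y) z + g y (nabla x z) = 0 := by
  rw [Matrix.trace_fin_two] at hy₁ hy₂ hz₁ hz₂
  have a₁ := eq_neg_of_add_eq_zero_right hy₁
  have a₂ := eq_neg_of_add_eq_zero_right hy₂
  have b₁ := eq_neg_of_add_eq_zero_right hz₁
  have b₂ := eq_neg_of_add_eq_zero_right hz₂
  simp only [g, ip, nabla, cross, Matrix.add_apply, Matrix.sub_apply, Matrix.smul_apply,
    Matrix.mul_apply, Fin.sum_univ_two, smul_eq_mul, a₁, a₂, b₁, b₂]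
  ring

/-! ### Smooth maps into `SL(2,ℝ) × SL(2,ℝ)` -/

section Maps

variable {E : Type*} [NormedAddCommGroup E] [NormedSpace ℝ E] {H : Type*} [TopologicalSpace H]
  (I : ModelWithCorners ℝ E H) {M : Type*} [TopologicalSpace M] [ChartedSpace H M]

/-- Smoothness of a map `F = (A, B)`. -/
def IsSmooth (F : M → SLxSL) : Prop :=
  ∀ i j : Fin 2, ContMDiff I 𝓘(ℝ, ℝ) ∞ (fun q => (F q).1.1 i j) ∧
    ContMDiff I 𝓘(ℝ, ℝ) ∞ (fun q => (F q).2.1 i j)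

/-- Entrywise derivative of a matrix valued function in the direction of a tangent vector. -/
def matDeriv (f : M → Mat) (p : M) (v : TangentSpace I p) : Mat :=
  Matrix.of fun i j => (mfderiv I 𝓘(ℝ, ℝ) (fun q => f q i j) p v : ℝ)

/-- The differential of `F = (A, B)` in left trivialization: the pair `(α, β)` with
`dF(v) = (Aα, Bβ)`. -/
def diff (F : M → SLxSL) (p : M) (v : TangentSpace I p) : Mat × Mat :=
  ((F p).1⁻¹.1 * matDeriv I (fun q => (F q).1.1) p v,
   (F p).2⁻¹.1 * matDeriv I (fun q => (F q).2.1) p v)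

/-- The Levi-Civita covariant derivative `∇_v (dF(Y))` of the vector field `dF(Y)` along `F`,
in left trivialization. If `dF(Y) = ∑ yᵏ eₖ` in a frame of left invariant fields `eₖ`, it is
`∑ (v(yᵏ) eₖ + yᵏ ∇_{dF(v)} eₖ)`. -/
def covDeriv (F : M → SLxSL) (Y : (q : M) → TangentSpace I q) (p : M) (v : TangentSpace I p) :
    Mat × Mat :=
  (matDeriv I (fun q => (diff I F q (Y q)).1) p v,
   matDeriv I (fun q => (diff I F q (Y q)).2) p v) + nabla (diff I F p v) (diff I F p (Y p))

end Maps

/-- An isometry of `(SL(2,ℝ) × SL(2,ℝ), g)`: a bijection, smooth in both directions (tested on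
smooth curves), which preserves the metric `g`. -/
structure IsIsometry (Φ : SLxSL ≃ SLxSL) : Prop where
  smooth : ∀ c : ℝ → SLxSL, IsSmooth 𝓘(ℝ, ℝ) c → IsSmooth 𝓘(ℝ, ℝ) (fun τ => Φ (c τ))
  smooth_symm : ∀ c : ℝ → SLxSL, IsSmooth 𝓘(ℝ, ℝ) c → IsSmooth 𝓘(ℝ, ℝ) (fun τ => Φ.symm (c τ))
  preserves : ∀ c : ℝ → SLxSL, IsSmooth 𝓘(ℝ, ℝ) c → ∀ (τ : ℝ) (v : TangentSpace 𝓘(ℝ, ℝ) τ),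
    g (diff 𝓘(ℝ, ℝ) (fun τ => Φ (c τ)) τ v) (diff 𝓘(ℝ, ℝ) (fun τ => Φ (c τ)) τ v)
      = g (diff 𝓘(ℝ, ℝ) c τ v) (diff 𝓘(ℝ, ℝ) c τ v)

/-- The map `(p, q) ↦ (apc, bqc)`. -/
def translation (a b c : SL(2, ℝ)) : SLxSL ≃ SLxSL where
  toFun x := (a * x.1 * c, b * x.2 * c)
  invFun x := (a⁻¹ * x.1 * c⁻¹, b⁻¹ * x.2 * c⁻¹)
  left_inv x := by ext1 <;> simp [mul_assoc]
  right_inv x := by ext1 <;> simp [mul_assoc]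

/-! ### Curvature of a metric on an open set of the plane -/

/-- The plane, on which surfaces are modelled. -/
abbrev Plane : Type := EuclideanSpace ℝ (Fin 2)

/-- Partial derivative in the `i`-th coordinate. -/
def pd (i : Fin 2) (f : Plane → ℝ) (x : Plane) : ℝ := fderiv ℝ f x (EuclideanSpace.single i 1)

/-- Christoffel symbols `Γᵏᵢⱼ` of the metric with coefficients `m`. -/
def christoffel (m : Plane → Mat) (k i j : Fin 2) (x : Plane) : ℝ :=
  1 / 2 * ∑ l, (m x)⁻¹ k l *
    (pd i (fun y => m y j l) x + pd j (fun y => m y i l) x - pd l (fun y => m y i j) x)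

/-- Curvature components: `R(∂ᵢ, ∂ⱼ) ∂ₖ = ∑ₗ riemann m l k i j ∂ₗ`. -/
def riemann (m : Plane → Mat) (l k i j : Fin 2) (x : Plane) : ℝ :=
  pd i (christoffel m l j k) x - pd j (christoffel m l i k) x
    + ∑ n, (christoffel m l i n x * christoffel m n j k x
        - christoffel m l j n x * christoffel m n i k x)

/-- Gaussian curvature `g(R(∂₁, ∂₂)∂₂, ∂₁) / det(gᵢⱼ)`. -/
def gaussCurv (m : Plane → Mat) (x : Plane) : ℝ :=
  (∑ l, m x 0 l * riemann m l 1 0 1 x) / (m x).det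

/-! ### Almost complex surfaces -/

section Surfaces

variable {M : Type*} [TopologicalSpace M] [ChartedSpace Plane M]

/-- `F` is a smooth immersion whose tangent planes satisfy `J(TM) = TM`. (Since `J² = -Id`, the
inclusion `J(TM) ⊆ TM` is enough.) -/
structure IsAlmostComplexSurface (F : M → SLxSL) : Prop where
  smooth : IsSmooth (𝓡 2) F
  immersion : ∀ p : M, Function.Injective (diff (𝓡 2) F p)
  invariant : ∀ (p : M) (v : TangentSpace (𝓡 2) p),
    ∃ w : TangentSpace (𝓡 2) p, J (diff (𝓡 2) F p v) = diff (𝓡 2) F p w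

/-- The induced metric is negative definite. -/
def IsNegDefSurface (F : M → SLxSL) : Prop :=
  ∀ (p : M) (v : TangentSpace (𝓡 2) p), v ≠ 0 → g (diff (𝓡 2) F p v) (diff (𝓡 2) F p v) < 0

/-- The second fundamental form vanishes: for every tangent vector `v` and every vector field `Y`
of `M` smooth near its base point, `∇_v (dF(Y))` has no normal component, i.e. is tangent. -/
def IsTotallyGeodesic [IsManifold (𝓡 2) ∞ M] (F : M → SLxSL) : Prop :=
  ∀ (p : M) (Y : (q : M) → TangentSpace (𝓡 2) q),
    ContMDiffAt (𝓡 2) (𝓡 2).tangent ∞ (fun q => (⟨q, Y q⟩ : TangentBundle (𝓡 2) M)) p →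
    ∀ v : TangentSpace (𝓡 2) p, ∃ w : TangentSpace (𝓡 2) p,
      covDeriv (𝓡 2) F Y p v = diff (𝓡 2) F p w

/-- Coefficients of the induced metric in the chart of `M` at `p`. -/
def metricCoeff (F : M → SLxSL) (p : M) (x : Plane) : Mat :=
  Matrix.of fun i j =>
    g (diff (𝓡 2) (F ∘ (chartAt Plane p).symm) x (EuclideanSpace.single i (1 : ℝ) : Plane))
      (diff (𝓡 2) (F ∘ (chartAt Plane p).symm) x (EuclideanSpace.single j (1 : ℝ) : Plane))

/-- The Gaussian curvature of the induced metric vanishes at every point. -/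
def IsFlat (F : M → SLxSL) : Prop :=
  ∀ p : M, gaussCurv (metricCoeff F p) (chartAt Plane p p) = 0

end Surfaces

/-- The matrix with rows `(cos θ, sin θ)` and `(-sin θ, cos θ)`. -/
def rot (θ : ℝ) : SL(2, ℝ) :=
  ⟨!![Real.cos θ, Real.sin θ; -Real.sin θ, Real.cos θ], by
    rw [Matrix.det_fin_two_of]
    nlinarith [Real.sin_sq_add_cos_sq θ]⟩

/-- The immersion `(s, t) ↦ (A(s, t), B(s, t))`. -/
def model (s t : ℝ) : SLxSL :=
  (rot (1 / √2 * (√3 * s - t)), rot (1 / √2 * (√3 * s + t)))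

end NKSL2

end

/-! In left trivialization a tangent plane of the surface is a J-invariant plane in pairs (α, β) of
trace zero matrices. If the second fundamental form vanishes, covariant derivatives of tangent
fields are tangent, so the plane is invariant under the ambient curvature (`curvature_mem_range`);
in particular R(x, Jx)x is a combination of x and Jx.

For x = (α, β) this is a purely algebraic condition (`curv_J_self`). If α and β do not commute they
are linearly independent, and comparing coefficients gives |α|² = |β|² = 2⟨α, β⟩ with |α|² = g(x, x)
< 0, which contradicts the reverse Cauchy inequality for time-like vectors of the Lorentzian space
sl(2,ℝ). Hence α and β commute (`commute_of_curv`), so they are multiples of one time-like unit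
vector ε, and the tangent plane is ℝε × ℝε (`exists_unitPlane_of_curvature`).

On such a plane `nabla` vanishes, so tangency of covariant derivatives becomes tangency of ordinary
derivatives. This makes the line ℝε locally constant (`eventually_mem_unitPlane`), and connectedness
makes it constant on M (`exists_diff_mem_unitPlane`).

No integration is needed: since dF takes values in ℝε × ℝε, the conjugates AεA⁻¹ and BεB⁻¹ have zero
derivative (`conj_eq_of_diff_mem_unitPlane`). Thus A and B each stay in one coset of the centralizer
of ε. Conjugating ε to a multiple of the rotation generator puts both factors, after a translation,
in the rotation group. Smooth local angles u, w of the factors are then local coordinates because F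
is an immersion, and a linear change turns them into (s, t) (`exists_coordinates`). -/

open scoped Topology

namespace NKSL2

/-! ### Algebra of the left trivialized tangent planes -/

/-- The curvature of `nabla` on left invariant fields. -/
noncomputable def curv (x y z : Mat × Mat) : Mat × Mat :=
  nabla x (nabla y z) - nabla y (nabla x z) - nabla (x * y - y * x) z

theorem trace_zero_apply {X : Mat} (h : X.trace = 0) : X 1 1 = -X 0 0 := by
  rw [Matrix.trace_fin_two] at h
  linarith

theorem cross_add_left (X Y Z : Mat) : cross (X + Y) Z = cross X Z + cross Y Z := by
  simp only [cross, add_mul, mul_add, ← smul_add]; congr 1; abel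

theorem cross_add_right (X Y Z : Mat) : cross X (Y + Z) = cross X Y + cross X Z := by
  simp only [cross, add_mul, mul_add, ← smul_add]; congr 1; abel

theorem cross_smul_left (r : ℝ) (X Y : Mat) : cross (r • X) Y = r • cross X Y := by
  simp only [cross, smul_mul_assoc, mul_smul_comm, ← smul_sub, smul_comm r]

theorem cross_smul_right (r : ℝ) (X Y : Mat) : cross X (r • Y) = r • cross X Y := by
  simp only [cross, smul_mul_assoc, mul_smul_comm, ← smul_sub, smul_comm r]

theorem cross_neg_left (X Y : Mat) : cross (-X) Y = -cross X Y := by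
  simpa using cross_smul_left (-1) X Y

theorem cross_neg_right (X Y : Mat) : cross X (-Y) = -cross X Y := by
  simpa using cross_smul_right (-1) X Y

theorem cross_self (X : Mat) : cross X X = 0 := by simp [cross]

theorem cross_zero_left (X : Mat) : cross 0 X = 0 := by simp [cross]

theorem cross_zero_right (X : Mat) : cross X 0 = 0 := by simp [cross]

theorem cross_anticomm (X Y : Mat) : cross Y X = -cross X Y := by
  rw [cross, cross, ← smul_neg, neg_sub]

/-- For trace zero matrices Cayley–Hamilton reads X² = ⟨X, X⟩·1, and its polarization XY + YX = 2⟨X,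
Y⟩·1 gives this Lorentzian triple product rule. It is the only feature of sl(2,ℝ) that the curvature
computation uses beyond bilinearity and antisymmetry. -/
theorem cross_cross_self {X Y : Mat} (hX : X.trace = 0) (hY : Y.trace = 0) :
    cross X (cross X Y) = ip X X • Y - ip X Y • X := by
  have a := trace_zero_apply hX
  have b := trace_zero_apply hY
  ext i j
  fin_cases i <;> fin_cases j <;>
  · simp [cross, ip, Matrix.mul_apply, Fin.sum_univ_two, a, b]
    ring

theorem ip_comm (X Y : Mat) : ip X Y = ip Y X := by simp only [ip]; ring

theorem mul_sub_mul_eq_cross (x y : Mat × Mat) :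
    x * y - y * x = ((2 : ℝ) • cross x.1 y.1, (2 : ℝ) • cross x.2 y.2) := by
  ext1 <;> simp [cross, smul_smul]

/-- After trilinear expansion only double cross products of α and β remain, and the triple product
rule turns them into combinations of α and β. The first term is tangent; the other two are the
obstruction to curvature invariance of the plane spanned by x and Jx. -/
theorem curv_J_self (x : Mat × Mat) (h₁ : x.1.trace = 0) (h₂ : x.2.trace = 0) :
    curv x (J x) x = (8 / 9 * (ip x.1 x.1 - ip x.1 x.2 + ip x.2 x.2)) • J x
      + (4 / 3 * (1 / √3) * (ip x.2 x.2 - ip x.1 x.1)) • (x.2, x.1)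
      + (4 / 9 * (ip x.1 x.1 - 4 * ip x.1 x.2 + ip x.2 x.2)) • J (x.2, x.1) := by
  obtain ⟨α, β⟩ := x
  have a : cross α (cross α β) = _ := cross_cross_self h₁ h₂
  have b : cross β (cross β α) = _ := cross_cross_self h₂ h₁
  rw [cross_anticomm α β, cross_neg_right, neg_eq_iff_eq_neg, ip_comm β α] at b
  unfold J curv
  rw [mul_sub_mul_eq_cross]
  -- Both sides are linear in 1/√3, so its value plays no role.
  generalize (1 / √3 : ℝ) = k
  ext1 <;>
  · simp only [nabla, sub_eq_add_neg, cross_add_left, cross_add_right, cross_smul_left,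
      cross_smul_right, cross_neg_left, cross_neg_right, cross_self, cross_zero_left,
      cross_zero_right, cross_anticomm α β,
      cross_anticomm α (cross α β), cross_anticomm β (cross α β), a, b, Prod.fst_add, Prod.snd_add,
      Prod.fst_neg, Prod.snd_neg, Prod.smul_fst, Prod.smul_snd]
    module

/-- A linear combination of `α` and `β` vanishes only trivially if they do not commute. -/
theorem eq_zero_of_lin_comb {α β : Mat} {u v : ℝ} (h : u • α + v • β = 0) (hc : α * β ≠ β * α) :
    u = 0 ∧ v = 0 := by
  -- Bracketing the relation with β isolates u; bracketing with α isolates v.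
  have h1 : u • (α * β - β * α) = 0 := by
    have : u • (α * β - β * α) = (u • α + v • β) * β - β * (u • α + v • β) := by
      simp only [add_mul, mul_add, smul_mul_assoc, mul_smul_comm, smul_sub]
      abel
    rw [this, h]; simp
  have h2 : v • (α * β - β * α) = 0 := by
    have : v • (α * β - β * α) = α * (u • α + v • β) - (u • α + v • β) * α := by
      simp only [add_mul, mul_add, smul_mul_assoc, mul_smul_comm, smul_sub]
      abel
    rw [this, h]; simp
  have h0 := sub_ne_zero.mpr hc
  exact ⟨(smul_eq_zero.mp h1).resolve_right h0, (smul_eq_zero.mp h2).resolve_right h0⟩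

/-- The reverse Cauchy inequality excludes this configuration of time-like vectors. -/
theorem not_ip_self_neg {α β : Mat} (h₁ : α.trace = 0) (h₂ : β.trace = 0)
    (h : ip α α = ip β β) (h' : 2 * ip α β = ip α α) : ¬ ip α α < 0 := by
  intro hn
  have a := trace_zero_apply h₁
  have b := trace_zero_apply h₂
  -- The antisymmetric part is the time-like direction of sl(2,ℝ). With r and s the antisymmetric
  -- parts of α and β, the vector rβ - sα has none, so its square is nonnegative; the left side is
  -- that square.
  have key : (α 0 1 - α 1 0) ^ 2 * ip β β + (β 0 1 - β 1 0) ^ 2 * ip α α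
      - 2 * ((α 0 1 - α 1 0) * (β 0 1 - β 1 0)) * ip α β ≥ 0 := by
    have : (α 0 1 - α 1 0) ^ 2 * ip β β + (β 0 1 - β 1 0) ^ 2 * ip α α
      - 2 * ((α 0 1 - α 1 0) * (β 0 1 - β 1 0)) * ip α β
      = ((α 0 1 - α 1 0) * β 0 0 - (β 0 1 - β 1 0) * α 0 0) ^ 2
        + ((α 0 1 - α 1 0) * ((β 0 1 + β 1 0) / 2) - (β 0 1 - β 1 0) * ((α 0 1 + α 1 0) / 2)) ^ 2 := by
      simp only [ip, a, b]; ring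
    rw [this]; positivity
  -- A symmetric trace zero matrix is never time-like.
  have hr : α 0 1 - α 1 0 ≠ 0 := by
    intro h0
    have : α 1 0 = α 0 1 := by linarith
    simp only [ip, a, this] at hn
    nlinarith [sq_nonneg (α 0 0), sq_nonneg (α 0 1)]
  generalize α 0 1 - α 1 0 = r at *
  generalize β 0 1 - β 1 0 = s at *
  rw [← h] at key
  have e : r ^ 2 * ip α α + s ^ 2 * ip α α - 2 * (r * s) * ip α β
      = ip α α * ((s - r / 2) ^ 2 + 3 / 4 * r ^ 2) := by
    linear_combination (-(r * s)) * h'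
  rw [e] at key
  have : 0 < (s - r / 2) ^ 2 + 3 / 4 * r ^ 2 := by positivity
  nlinarith

theorem commute_of_curv {x : Mat × Mat} (h₁ : x.1.trace = 0) (h₂ : x.2.trace = 0)
    (hg : g x x < 0) {a b : ℝ} (h : curv x (J x) x = a • x + b • J x) :
    x.1 * x.2 = x.2 * x.1 := by
  by_contra hc
  rw [curv_J_self x h₁ h₂] at h
  have hk : (1 / √3 : ℝ) ≠ 0 := by positivity
  unfold J at h
  generalize (1 / √3 : ℝ) = k at *
  generalize hp : 8 / 9 * (ip x.1 x.1 - ip x.1 x.2 + ip x.2 x.2) = p at h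
  generalize hr : (ip x.2 x.2 - ip x.1 x.1) = r at h
  generalize hs : (ip x.1 x.1 - 4 * ip x.1 x.2 + ip x.2 x.2) = s at h
  obtain ⟨α, β⟩ := x
  rw [Prod.ext_iff] at h
  simp only [Prod.fst_add, Prod.snd_add, Prod.smul_fst, Prod.smul_snd] at h hr hs hc h₁ h₂
  obtain ⟨e₁, e₂⟩ := h
  obtain ⟨u₁, v₁⟩ := eq_zero_of_lin_comb (α := α) (β := β)
    (u := p * k - 4 / 9 * s * (2 * k) - a - b * k)
    (v := -2 * p * k + 4 / 3 * k * r + 4 / 9 * s * k + 2 * b * k)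
    (by rw [← sub_eq_zero] at e₁; rw [← e₁]; module) hc
  obtain ⟨u₂, v₂⟩ := eq_zero_of_lin_comb (α := α) (β := β)
    (u := 2 * p * k + 4 / 3 * k * r - 4 / 9 * s * k - 2 * b * k)
    (v := - p * k + 4 / 9 * s * (2 * k) - a + b * k)
    (by rw [← sub_eq_zero] at e₂; rw [← e₂]; module) hc
  -- The coefficient of β in the first component and that of α in the second add up to a multiple of
  -- `k * r`; the unknowns p, s and b cancel.
  have r0 : r = 0 := by
    have : k * r = 0 := by linarith
    exact (mul_eq_zero.mp this).resolve_left hk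
  have s0 : s = 0 := by
    have : k * s = 0 := by subst r0; linarith
    exact (mul_eq_zero.mp this).resolve_left hk
  -- With r = s = 0 the value g(x, x) reduces to ⟨α, α⟩, which is therefore negative.
  refine not_ip_self_neg h₁ h₂ (by linarith) (by linarith) ?_
  simp only [g, ip_comm β α] at hg
  linarith

/-- The triple product rule with vanishing cross product. If α is not null, β is a multiple of α. -/
theorem ip_smul_of_commute {α β : Mat} (h₁ : α.trace = 0) (h₂ : β.trace = 0)
    (h : α * β = β * α) : ip α α • β = ip α β • α := by
  have e := cross_cross_self h₁ h₂
  rw [cross, cross, h] at e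
  simpa [sub_eq_zero] using e.symm

theorem exists_unit_of_ip_neg {α : Mat} (h : α.trace = 0) (hn : ip α α < 0) :
    ∃ ε : Mat, ε.trace = 0 ∧ ip ε ε = -1 ∧ ∃ t : ℝ, α = t • ε := by
  have hs : 0 < √(-ip α α) := Real.sqrt_pos.mpr (by linarith)
  refine ⟨(√(-ip α α))⁻¹ • α, by simp [h], ?_, √(-ip α α), by
    rw [smul_smul, mul_inv_cancel₀ hs.ne', one_smul]⟩
  have e : ip ((√(-ip α α))⁻¹ • α) ((√(-ip α α))⁻¹ • α) = (√(-ip α α) ^ 2)⁻¹ * ip α α := by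
    rw [← inv_pow]
    generalize (√(-ip α α))⁻¹ = k
    simp only [ip, Matrix.smul_apply, smul_eq_mul]; ring
  rw [e, Real.sq_sqrt (by linarith), inv_neg, neg_mul, inv_mul_cancel₀ hn.ne]

/-- The product of the line spanned by `ε` with the plane. -/
def unitPlane (ε : Mat) : Submodule ℝ (Mat × Mat) :=
  (Submodule.span ℝ {ε}).prod (Submodule.span ℝ {ε})

theorem mem_unitPlane {ε : Mat} {x : Mat × Mat} :
    x ∈ unitPlane ε ↔ ∃ a b : ℝ, x = (a • ε, b • ε) := by
  simp only [unitPlane, Submodule.mem_prod, Submodule.mem_span_singleton]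
  constructor
  · rintro ⟨⟨a, ha⟩, b, hb⟩
    exact ⟨a, b, Prod.ext ha.symm hb.symm⟩
  · rintro ⟨a, b, rfl⟩
    exact ⟨⟨a, rfl⟩, b, rfl⟩

theorem J_mem_unitPlane {ε : Mat} {x : Mat × Mat} (h : x ∈ unitPlane ε) : J x ∈ unitPlane ε := by
  obtain ⟨h₁, h₂⟩ := Submodule.mem_prod.mp h
  exact Submodule.mem_prod.mpr ⟨Submodule.smul_mem _ _ (Submodule.sub_mem _ h₁
    (Submodule.smul_mem _ _ h₂)), Submodule.smul_mem _ _ (Submodule.sub_mem _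
    (Submodule.smul_mem _ _ h₁) h₂)⟩

theorem nabla_eq_zero {ε : Mat} {x y : Mat × Mat} (hx : x ∈ unitPlane ε) (hy : y ∈ unitPlane ε) :
    nabla x y = 0 := by
  obtain ⟨a, b, rfl⟩ := mem_unitPlane.mp hx
  obtain ⟨c, d, rfl⟩ := mem_unitPlane.mp hy
  have : ∀ s t : ℝ, cross (s • ε) (t • ε) = 0 := by
    intro s t
    rw [cross_smul_left, cross_smul_right, cross_self, smul_zero, smul_zero]
  simp [nabla, this]

/-- One of the two components must be time-like and then spans the line containing both. Otherwise
both squares are nonnegative, commuting gives equality in Cauchy's inequality, and the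
arithmetic–geometric mean inequality forces g(x, x) ≥ 0. -/
theorem exists_unitPlane_of_commute {x : Mat × Mat} (h₁ : x.1.trace = 0) (h₂ : x.2.trace = 0)
    (hg : g x x < 0) (h : x.1 * x.2 = x.2 * x.1) :
    ∃ ε : Mat, ε.trace = 0 ∧ ip ε ε = -1 ∧ x ∈ unitPlane ε := by
  have comm := ip_comm x.2 x.1
  have e₁ := ip_smul_of_commute h₁ h₂ h
  have e₂ := ip_smul_of_commute h₂ h₁ h.symm
  rcases lt_or_ge (ip x.1 x.1) 0 with ha | ha
  · obtain ⟨ε, hε, hε', t, ht⟩ := exists_unit_of_ip_neg h₁ ha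
    refine ⟨ε, hε, hε', mem_unitPlane.mpr ⟨t, (ip x.1 x.1)⁻¹ * ip x.1 x.2 * t, Prod.ext ht ?_⟩⟩
    rw [mul_smul, mul_smul, ← ht, ← e₁, smul_smul, inv_mul_cancel₀ ha.ne, one_smul]
  rcases lt_or_ge (ip x.2 x.2) 0 with hb | hb
  · obtain ⟨ε, hε, hε', t, ht⟩ := exists_unit_of_ip_neg h₂ hb
    refine ⟨ε, hε, hε', mem_unitPlane.mpr ⟨(ip x.2 x.2)⁻¹ * ip x.2 x.1 * t, t, Prod.ext ?_ ht⟩⟩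
    rw [mul_smul, mul_smul, ← ht, ← e₂, smul_smul, inv_mul_cancel₀ hb.ne, one_smul]
  exfalso
  have h3 : ip x.1 x.1 * ip x.2 x.2 = ip x.1 x.2 ^ 2 := by
    have l : ∀ (s : ℝ) (Y : Mat), ip x.2 (s • Y) = s * ip x.2 Y := by
      intro s Y; simp only [ip, Matrix.smul_apply, smul_eq_mul]; ring
    have := congrArg (ip x.2) e₁
    rw [l, l, comm] at this
    linarith
  simp only [g, comm] at hg
  nlinarith [sq_nonneg (ip x.1 x.1 - ip x.2 x.2)]

theorem J_J (x : Mat × Mat) : J (J x) = -x := by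
  have h : (1 / √3 : ℝ) * (1 / √3) = 1 / 3 := by
    rw [div_mul_div_comm, Real.mul_self_sqrt (by norm_num)]; norm_num
  unfold J
  generalize (1 / √3 : ℝ) = k at *
  ext i j
  · simp; linear_combination (-3 * x.1 i j) * h
  · simp; linear_combination (-3 * x.2 i j) * h

end NKSL2

/-! ### Autoparallel families of planes -/

section Analysis

variable {E P : Type*} [NormedAddCommGroup E] [NormedSpace ℝ E] [NormedAddCommGroup P]
  [NormedSpace ℝ P]

theorem eventually_eq_of_fderiv_eq_zero {f : E → P} {x : E}
    (h : ∀ᶠ y in 𝓝 x, DifferentiableAt ℝ f y ∧ fderiv ℝ f y = 0) : ∀ᶠ y in 𝓝 x, f y = f x := by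
  obtain ⟨r, hr, hb⟩ := Metric.eventually_nhds_iff_ball.mp h
  filter_upwards [Metric.ball_mem_nhds x hr] with y hy
  exact Metric.isOpen_ball.is_const_of_fderiv_eq_zero (convex_ball x r).isPreconnected
    (fun z hz => (hb z hz).1.differentiableWithinAt) (fun z hz => (hb z hz).2) hy
    (Metric.mem_ball_self hr)

/-- A function whose derivative is everywhere proportional to it has locally constant direction. -/
theorem eventually_mem_line_of_fderiv {α : E → P} {x : E} (h0 : α x ≠ 0)
    (h : ∀ᶠ y in 𝓝 x, DifferentiableAt ℝ α y ∧ ∀ e, ∃ t : ℝ, fderiv ℝ α y e = t • α y) :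
    ∀ᶠ y in 𝓝 x, ∃ t : ℝ, α y = t • α x := by
  -- Rescaling α by a linear form that equals 1 at the base value removes the proportional part of
  -- the derivative, so the rescaled function is locally constant.
  obtain ⟨l, hl⟩ := SeparatingDual.exists_eq_one (R := ℝ) h0
  have hcont : ContinuousAt (fun y => l (α y)) x :=
    l.continuous.continuousAt.comp h.self_of_nhds.1.continuousAt
  have hne : ∀ᶠ y in 𝓝 x, l (α y) ≠ 0 := hcont.eventually_ne (by rw [hl]; exact one_ne_zero)
  have hconst : ∀ᶠ y in 𝓝 x, (l (α y))⁻¹ • α y = (l (α x))⁻¹ • α x := by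
    refine eventually_eq_of_fderiv_eq_zero (f := fun y => (l (α y))⁻¹ • α y) ?_
    filter_upwards [h, hne] with y hy hy'
    have hd := hy.1.hasFDerivAt
    have hs := ((hasDerivAt_inv hy').comp_hasFDerivAt y (l.hasFDerivAt.comp y hd)).smul hd
    refine ⟨hs.differentiableAt, ?_⟩
    refine hs.fderiv.trans ?_
    ext e
    obtain ⟨t, ht⟩ := hy.2 e
    simp only [add_apply, smul_apply,
      ContinuousLinearMap.smulRight_apply, ContinuousLinearMap.comp_apply, Function.comp_apply,
      ht, map_smul, smul_eq_mul, zero_apply, smul_smul, ← add_smul]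
    rw [show (l (α y))⁻¹ * t + -(l (α y) ^ 2)⁻¹ * (t * l (α y)) = 0 by field_simp; ring, zero_smul]
  filter_upwards [hconst, hne] with y hy hy'
  refine ⟨l (α y), ?_⟩
  rw [hl, inv_one, one_smul] at hy
  rw [← hy, smul_smul, mul_inv_cancel₀ hy', one_smul]

/-- A differentiable section of the image of an injective family of linear maps lifts to a
differentiable function. -/
theorem exists_differentiableAt_lift [FiniteDimensional ℝ E] [FiniteDimensional ℝ P]
    {X : E → E →L[ℝ] P} {D : E → P}
    {x : E} (hX : DifferentiableAt ℝ X x) (hD : DifferentiableAt ℝ D x)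
    (hinj : Function.Injective (X x)) (h : ∀ᶠ y in 𝓝 x, ∃ w, D y = X y w) :
    ∃ c : E → E, DifferentiableAt ℝ c x ∧ ∀ᶠ y in 𝓝 x, D y = X y (c y) := by
  have : CompleteSpace E := FiniteDimensional.complete ℝ E
  obtain ⟨l, hl⟩ := (X x : E →ₗ[ℝ] P).exists_leftInverse_of_injective
    (LinearMap.ker_eq_bot.mpr hinj)
  set L : P →L[ℝ] E := LinearMap.toContinuousLinearMap l
  have h1 : L ∘L X x = 1 := by
    ext e
    exact LinearMap.congr_fun hl e
  -- L inverts X x on the left, so `L ∘L X y` stays invertible near x, and (L X y)⁻¹ L recovers the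
  -- preimage differentiably.
  have hT : DifferentiableAt ℝ (fun y => L ∘L X y) x :=
    (differentiableAt_const L).clm_comp hX
  have hunit : ∀ᶠ y in 𝓝 x, IsUnit (L ∘L X y) := by
    refine hT.continuousAt.eventually_mem (Units.isOpen.mem_nhds ?_)
    change IsUnit (L ∘L X x)
    rw [h1]
    exact isUnit_one
  refine ⟨fun y => Ring.inverse (L ∘L X y) (L (D y)), ?_, ?_⟩
  · have hi : DifferentiableAt ℝ (Ring.inverse : (E →L[ℝ] E) → _) (L ∘L X x) := by
      rw [h1]
      exact differentiableAt_inverse isUnit_one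
    exact (hi.comp (f := fun y => L ∘L X y) x hT).clm_apply (L.differentiableAt.comp x hD)
  · filter_upwards [h, hunit] with y ⟨w, hw⟩ hy
    have : Ring.inverse (L ∘L X y) ((L ∘L X y) w) = w := by
      rw [← mul_apply_eq_comp, Ring.inverse_mul_cancel _ hy]
      rfl
    rw [hw]
    congr 1
    exact this.symm

/-- The planes `range (X y)` of an autoparallel family are invariant under their curvature. -/
theorem curvature_mem_range [FiniteDimensional ℝ E] [FiniteDimensional ℝ P]
    {X : E → E →L[ℝ] P} {x : E}
    (hX : ContDiffAt ℝ 2 X x) (hinj : Function.Injective (X x)) (nab : P →L[ℝ] P →L[ℝ] P)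
    (br : P → P → P)
    (mc : ∀ e f, fderiv ℝ X x e f - fderiv ℝ X x f e = -br (X x e) (X x f))
    (tg : ∀ᶠ y in 𝓝 x, ∀ e f, ∃ w, fderiv ℝ X y e f + nab (X y e) (X y f) = X y w)
    (e f h : E) :
    ∃ w, nab (X x e) (nab (X x f) (X x h)) - nab (X x f) (nab (X x e) (X x h))
      - nab (br (X x e) (X x f)) (X x h) = X x w := by
  have hXd : DifferentiableAt ℝ X x := hX.differentiableAt (by simp)
  have hX' : DifferentiableAt ℝ (fderiv ℝ X) x :=
    (hX.fderiv_right (m := 1) (by norm_num)).differentiableAt (by simp)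
  have hsymm : fderiv ℝ (fderiv ℝ X) x e f = fderiv ℝ (fderiv ℝ X) x f e :=
    (hX.isSymmSndFDerivAt (by simp)) e f
  -- Write the covariant derivative of X h along f as X c with c differentiable, then differentiate
  -- along e. Antisymmetrizing in e and f cancels the second derivatives of X.
  have key : ∀ e f : E, ∃ c v : E, fderiv ℝ X x f h + nab (X x f) (X x h) = X x c ∧
      fderiv ℝ (fderiv ℝ X) x e f h + (nab (fderiv ℝ X x e f) (X x h)
        + nab (X x f) (fderiv ℝ X x e h)) = fderiv ℝ X x e c + X x v := by
    intro e f
    have hDf : HasFDerivAt (fun y => fderiv ℝ X y f h + nab (X y f) (X y h)) _ x :=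
      ((hX'.hasFDerivAt.clm_apply (hasFDerivAt_const f x)).clm_apply (hasFDerivAt_const h x)).add
        ((nab.hasFDerivAt.comp x (hXd.hasFDerivAt.clm_apply (hasFDerivAt_const f x))).clm_apply
          (hXd.hasFDerivAt.clm_apply (hasFDerivAt_const h x)))
    obtain ⟨c, hc, hc'⟩ := exists_differentiableAt_lift hXd hDf.differentiableAt hinj
      (tg.mono fun y hy => hy f h)
    refine ⟨c x, fderiv ℝ c x e, hc'.self_of_nhds, ?_⟩
    have := (hDf.congr_of_eventuallyEq (hc'.mono fun y hy => hy.symm)).unique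
      (hXd.hasFDerivAt.clm_apply hc.hasFDerivAt)
    have := DFunLike.congr_fun this e
    simp at this
    rw [add_comm (nab _ _), this, add_comm]
  obtain ⟨c, v, hc, hcv⟩ := key e f
  obtain ⟨d, u, hd, hdu⟩ := key f e
  obtain ⟨w₁, hw₁⟩ := tg.self_of_nhds e c
  obtain ⟨w₂, hw₂⟩ := tg.self_of_nhds f d
  refine ⟨w₁ - w₂ + v - u, ?_⟩
  rw [← hsymm] at hdu
  -- The Maurer–Cartan equation trades the remaining first derivatives for the bracket term of the
  -- curvature.
  have hbr : nab (br (X x e) (X x f)) (X x h)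
      = nab (fderiv ℝ X x f e) (X x h) - nab (fderiv ℝ X x e f) (X x h) := by
    rw [← neg_eq_iff_eq_neg.mpr (mc e f)]
    simp
  rw [eq_sub_of_add_eq hd, map_sub] at hcv
  rw [eq_sub_of_add_eq hc, map_sub, eq_sub_of_add_eq hw₂] at hdu
  rw [eq_sub_of_add_eq hw₁] at hcv
  rw [hbr]
  simp only [map_sub, map_add]
  linear_combination (norm := module) hcv - hdu

/-- The Maurer–Cartan equation for the logarithmic derivative of a function with values in the
units of an algebra. -/
theorem maurerCartan {A : Type*} [NormedRing A] [NormedAlgebra ℝ A] {G Gi : E → A} {x : E}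
    (hG : ContDiffAt ℝ 2 G x) (hGi : DifferentiableAt ℝ Gi x)
    (h : ∀ᶠ y in 𝓝 x, Gi y * G y = 1) (h' : G x * Gi x = 1) (e f : E) :
    fderiv ℝ (fun y => (ContinuousLinearMap.mul ℝ A (Gi y)).comp (fderiv ℝ G y)) x e f
      - fderiv ℝ (fun y => (ContinuousLinearMap.mul ℝ A (Gi y)).comp (fderiv ℝ G y)) x f e
      = -((Gi x * fderiv ℝ G x e) * (Gi x * fderiv ℝ G x f)
        - (Gi x * fderiv ℝ G x f) * (Gi x * fderiv ℝ G x e)) := by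
  have hGd : DifferentiableAt ℝ G x := hG.differentiableAt (by simp)
  have hG' : DifferentiableAt ℝ (fderiv ℝ G) x :=
    (hG.fderiv_right (m := 1) (by norm_num)).differentiableAt (by simp)
  have hsymm : fderiv ℝ (fderiv ℝ G) x e f = fderiv ℝ (fderiv ℝ G) x f e :=
    (hG.isSymmSndFDerivAt (by simp)) e f
  -- Differentiating G⁻¹G = 1 gives d(G⁻¹) = -G⁻¹ dG G⁻¹.
  have hinv : ∀ v, fderiv ℝ Gi x v = -(Gi x * fderiv ℝ G x v * Gi x) := by
    intro v
    have h1 := (hGi.hasFDerivAt.mul' hGd.hasFDerivAt).unique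
      ((hasFDerivAt_const (1 : A) x).congr_of_eventuallyEq h)
    have h2 := DFunLike.congr_fun h1 v
    simp only [add_apply, smul_apply, smul_eq_mul, zero_apply] at h2
    replace h2 : Gi x * fderiv ℝ G x v + fderiv ℝ Gi x v * G x = 0 := h2
    calc fderiv ℝ Gi x v = fderiv ℝ Gi x v * G x * Gi x := by rw [mul_assoc, h', mul_one]
      _ = _ := by rw [eq_neg_of_add_eq_zero_right h2, neg_mul]
  have hd : ∀ v w, fderiv ℝ (fun y => (ContinuousLinearMap.mul ℝ A (Gi y)).comp (fderiv ℝ G y)) x v w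
      = Gi x * fderiv ℝ (fderiv ℝ G) x v w + fderiv ℝ Gi x v * fderiv ℝ G x w := by
    intro v w
    have h1 := ((ContinuousLinearMap.mul ℝ A).hasFDerivAt.comp x hGi.hasFDerivAt).clm_comp
      hG'.hasFDerivAt
    have h2 := DFunLike.congr_fun (DFunLike.congr_fun h1.fderiv v) w
    exact h2
  rw [hd, hd, hinv, hinv, hsymm]
  noncomm_ring

end Analysis

/-! ### Tangent planes as fixed product planes in left trivialization -/

namespace NKSL2

section Frames

/-- The topology on `2 × 2` matrices given by the operator norm. -/
@[reducible]
noncomputable def matTopology : TopologicalSpace Mat :=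
  (Matrix.linftyOpNormedRing : NormedRing Mat).toMetricSpace.toPseudoMetricSpace.toUniformSpace.toTopologicalSpace

attribute [local instance] Matrix.linftyOpNormedRing Matrix.linftyOpNormedAlgebra matTopology

theorem nabla_add_left (x x' y : Mat × Mat) : nabla (x + x') y = nabla x y + nabla x' y := by
  ext1 <;>
  · simp only [nabla, Prod.fst_add, Prod.snd_add, cross_add_left]
    module

theorem nabla_add_right (x y y' : Mat × Mat) : nabla x (y + y') = nabla x y + nabla x y' := by
  ext1 <;>
  · simp only [nabla, Prod.fst_add, Prod.snd_add, cross_add_right]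
    module

theorem nabla_smul_left (r : ℝ) (x y : Mat × Mat) : nabla (r • x) y = r • nabla x y := by
  ext1 <;>
  · simp only [nabla, Prod.smul_fst, Prod.smul_snd, cross_smul_left]
    module

theorem nabla_smul_right (r : ℝ) (x y : Mat × Mat) : nabla x (r • y) = r • nabla x y := by
  ext1 <;>
  · simp only [nabla, Prod.smul_fst, Prod.smul_snd, cross_smul_right]
    module

/-- `nabla` as a continuous bilinear map. -/
noncomputable def nablaL : (Mat × Mat) →L[ℝ] (Mat × Mat) →L[ℝ] (Mat × Mat) :=
  LinearMap.toContinuousLinearMap ((LinearMap.toContinuousLinearMap :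
      ((Mat × Mat) →ₗ[ℝ] (Mat × Mat)) ≃ₗ[ℝ] _).toLinearMap ∘ₗ
    LinearMap.mk₂ ℝ nabla nabla_add_left nabla_smul_left nabla_add_right nabla_smul_right)

theorem exists_lin_comb {e f : Plane} (he : e ≠ 0) (h : ∀ a : ℝ, f ≠ a • e) (w : Plane) :
    ∃ a b : ℝ, w = a • e + b • f := by
  have hli : LinearIndependent ℝ ![e, f] :=
    (LinearIndependent.pair_iff' he).mpr fun a ha => h a ha.symm
  have hs := hli.span_eq_top_of_card_eq_finrank (by simp)
  have hw : w ∈ Submodule.span ℝ (Set.range ![e, f]) := hs ▸ Submodule.mem_top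
  rw [Matrix.range_cons, Matrix.range_cons, Matrix.range_empty, Set.union_empty,
    Set.singleton_union, Submodule.mem_span_pair] at hw
  obtain ⟨a, b, hab⟩ := hw
  exact ⟨a, b, hab.symm⟩

/-- J² = -1 excludes real eigenvalues; hence x and Jx span the tangent plane. -/
theorem J_ne_smul {x : Mat × Mat} (hx : x ≠ 0) (a : ℝ) : J x ≠ a • x := by
  intro h
  have hJ : J (a • x) = a • J x := by
    ext1 <;>
    · simp only [J, Prod.smul_fst, Prod.smul_snd]
      module
  have h1 := J_J x
  rw [h, hJ, h, smul_smul] at h1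
  have h2 : (a * a + 1) • x = 0 := by rw [add_smul, h1, one_smul, neg_add_cancel]
  exact (smul_eq_zero.mp h2).elim (fun h => by nlinarith [mul_self_nonneg a]) hx

/-- A negative definite `J`-invariant plane which is invariant under its own curvature is the
product of a time-like line with the plane. -/
theorem exists_unitPlane_of_curvature {X : Plane →L[ℝ] Mat × Mat}
    (htr : ∀ e, (X e).1.trace = 0 ∧ (X e).2.trace = 0)
    (hJ : ∀ e, ∃ f, J (X e) = X f) (hneg : ∀ e, e ≠ 0 → g (X e) (X e) < 0)
    (hcurv : ∀ e f h, ∃ w, curv (X e) (X f) (X h) = X w) :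
    ∃ ε : Mat, ε.trace = 0 ∧ ip ε ε = -1 ∧ ∀ e, X e ∈ unitPlane ε := by
  obtain ⟨e, he⟩ := exists_ne (0 : Plane)
  have hX : X e ≠ 0 := fun h0 => by
    have := hneg e he
    simp [h0, g, ip] at this
  obtain ⟨f, hf⟩ := hJ e
  have hcomb := exists_lin_comb he (f := f) fun a ha => J_ne_smul hX a (by rw [hf, ha, map_smul])
  obtain ⟨w, hw⟩ := hcurv e f e
  obtain ⟨a, b, rfl⟩ := hcomb w
  rw [← hf, map_add, map_smul, map_smul, ← hf] at hw
  obtain ⟨ε, h₁, h₂, hε⟩ := exists_unitPlane_of_commute (htr e).1 (htr e).2 (hneg e he)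
    (commute_of_curv (htr e).1 (htr e).2 (hneg e he) hw)
  refine ⟨ε, h₁, h₂, fun v => ?_⟩
  obtain ⟨a, b, rfl⟩ := hcomb v
  rw [map_add, map_smul, map_smul, ← hf]
  exact Submodule.add_mem _ (Submodule.smul_mem _ _ hε)
    (Submodule.smul_mem _ _ (J_mem_unitPlane hε))

/-- The tangent planes of a totally geodesic negative definite almost complex surface are locally
constant in the left trivialization. -/
theorem eventually_mem_unitPlane {X : Plane → Plane →L[ℝ] Mat × Mat} {x : Plane}
    (hX : ∀ᶠ y in 𝓝 x, ContDiffAt ℝ 2 X y)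
    (htr : ∀ᶠ y in 𝓝 x, ∀ e, (X y e).1.trace = 0 ∧ (X y e).2.trace = 0)
    (hinj : ∀ᶠ y in 𝓝 x, Function.Injective (X y))
    (hJ : ∀ᶠ y in 𝓝 x, ∀ e, ∃ f, J (X y e) = X y f)
    (hneg : ∀ᶠ y in 𝓝 x, ∀ e, e ≠ 0 → g (X y e) (X y e) < 0)
    (mc : ∀ᶠ y in 𝓝 x, ∀ e f, fderiv ℝ X y e f - fderiv ℝ X y f e
      = -(X y e * X y f - X y f * X y e))
    (tg : ∀ᶠ y in 𝓝 x, ∀ e f, ∃ w, fderiv ℝ X y e f + nabla (X y e) (X y f) = X y w) :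
    ∃ ε : Mat, ε.trace = 0 ∧ ip ε ε = -1 ∧ ∀ᶠ y in 𝓝 x, ∀ e, X y e ∈ unitPlane ε := by
  have hpt : ∀ᶠ y in 𝓝 x, ∃ ε : Mat, ε.trace = 0 ∧ ip ε ε = -1 ∧ ∀ e, X y e ∈ unitPlane ε := by
    filter_upwards [hX, htr, hinj, hJ, hneg, mc, eventually_eventually_nhds.mpr tg]
      with y h₁ h₂ h₃ h₄ h₅ h₆ h₇
    refine exists_unitPlane_of_curvature h₂ h₄ h₅ fun e f h => ?_
    exact curvature_mem_range h₁ h₃ nablaL (fun a b => a * b - b * a) h₆ h₇ e f h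
  obtain ⟨ε, hε₁, hε₂, hε⟩ := hpt.self_of_nhds
  refine ⟨ε, hε₁, hε₂, ?_⟩
  -- If all first components vanished, so would that of J(0, β), which is a nonzero multiple of β.
  -- The direction of this one component will determine the line ℝε.
  obtain ⟨e, he⟩ : ∃ e, (X x e).1 ≠ 0 := by
    by_contra! h0
    obtain ⟨e, he⟩ := exists_ne (0 : Plane)
    obtain ⟨f, hf⟩ := hJ.self_of_nhds e
    have h1 := h0 f
    rw [← hf, J, h0 e] at h1
    have h2 : (X x e).2 = 0 := by simpa using h1
    have := hneg.self_of_nhds e he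
    simp [g, ip, h0 e, h2] at this
  have hcont : ContinuousAt (fun y => (X y e).1) x :=
    (ContinuousLinearMap.fst ℝ Mat Mat).continuous.continuousAt.comp (f := fun y => X y e)
      (hX.self_of_nhds.continuousAt.clm_apply continuousAt_const)
  have hline : ∀ᶠ y in 𝓝 x, ∃ t : ℝ, (X y e).1 = t • (X x e).1 := by
    refine eventually_mem_line_of_fderiv (α := fun y => (X y e).1) he ?_
    filter_upwards [hX, tg, hpt, hcont.eventually_ne he] with y h₁ h₂ ⟨δ, _, _, hδ⟩ h₄
    have hd : HasFDerivAt (fun y => (X y e).1) _ y :=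
      (ContinuousLinearMap.fst ℝ Mat Mat).hasFDerivAt.comp y
        ((h₁.differentiableAt (by simp)).hasFDerivAt.clm_apply (hasFDerivAt_const e y))
    refine ⟨hd.differentiableAt, fun v => ?_⟩
    rw [hd.fderiv]
    obtain ⟨w, hw⟩ := h₂ v e
    -- The connection term drops out, so the plain derivative lies in the plane at y and its first
    -- component is a multiple of the first component of X y e.
    rw [nabla_eq_zero (hδ v) (hδ e), add_zero] at hw
    have e₁ : (((ContinuousLinearMap.fst ℝ Mat Mat).comp
      ((X y).comp (0 : Plane →L[ℝ] Plane) + (fderiv ℝ X y).flip e)) v) = (X y w).1 := by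
      rw [← hw]
      simp
    obtain ⟨a, b, hab⟩ := mem_unitPlane.mp (hδ w)
    obtain ⟨a', b', hab'⟩ := mem_unitPlane.mp (hδ e)
    rw [e₁]
    simp only [hab']
    have ha' : a' ≠ 0 := by
      rintro rfl
      rw [hab'] at h₄
      simp at h₄
    refine ⟨a * a'⁻¹, ?_⟩
    rw [hab, smul_smul, inv_mul_cancel_right₀ ha']
  filter_upwards [hline, hpt, hcont.eventually_ne he] with y ⟨t, ht⟩ ⟨δ, _, _, hδ⟩ hne v
  obtain ⟨a, b, hab⟩ := mem_unitPlane.mp (hε e)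
  obtain ⟨a', b', hab'⟩ := mem_unitPlane.mp (hδ e)
  obtain ⟨c, d, hcd⟩ := mem_unitPlane.mp (hδ v)
  have ha' : a' ≠ 0 := by
    rintro rfl
    rw [hab'] at hne
    simp at hne
  have hδε : δ = (a'⁻¹ * t * a) • ε := by
    rw [hab, hab'] at ht
    simp only at ht
    rw [mul_smul, mul_smul, ← ht, smul_smul, inv_mul_cancel₀ ha', one_smul]
  rw [hcd, hδε, smul_smul, smul_smul]
  exact mem_unitPlane.mpr ⟨_, _, rfl⟩

end Frames

end NKSL2

/-! ### Smooth maps into the group, their differentials, and translations -/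

namespace NKSL2

section Maps

attribute [local instance] Matrix.linftyOpNormedRing Matrix.linftyOpNormedAlgebra matTopology

variable {E : Type*} [NormedAddCommGroup E] [NormedSpace ℝ E]

/-- A matrix entry as a continuous linear form. -/
noncomputable def entryL (i j : Fin 2) : Mat →L[ℝ] ℝ :=
  LinearMap.toContinuousLinearMap (Matrix.entryLinearMap ℝ ℝ i j)

theorem contDiffAt_mat {n : WithTop ℕ∞} {f : E → Mat} {x : E}
    (h : ∀ i j, ContDiffAt ℝ n (fun y => f y i j) x) : ContDiffAt ℝ n f x := by
  have : f = fun y => ∑ i, ∑ j, f y i j • (Matrix.single i j (1 : ℝ) : Mat) := by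
    ext1 y
    conv_lhs => rw [Matrix.matrix_eq_sum_single (f y)]
    simp [Matrix.smul_single]
  rw [this]
  exact ContDiffAt.sum fun i _ => ContDiffAt.sum fun j _ => (h i j).smul contDiffAt_const

/-- The pair of matrices underlying an element of `SL(2,ℝ) × SL(2,ℝ)`. -/
def pairMat (x : SLxSL) : Mat × Mat := (x.1.1, x.2.1)

theorem pairMat_mul (x y : SLxSL) : pairMat (x * y) = pairMat x * pairMat y := by
  ext1 <;> simp [pairMat]

theorem pairMat_one : pairMat 1 = 1 := rfl

theorem pairMat_inv_mul (x : SLxSL) : pairMat x⁻¹ * pairMat x = 1 := by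
  rw [← pairMat_mul, inv_mul_cancel, pairMat_one]

theorem pairMat_mul_inv (x : SLxSL) : pairMat x * pairMat x⁻¹ = 1 := by
  rw [← pairMat_mul, mul_inv_cancel, pairMat_one]

theorem contDiffAt_pairMat {n : WithTop ℕ∞} {ψ : E → SLxSL} {x : E}
    (h : ∀ i j, ContDiffAt ℝ n (fun y => (ψ y).1.1 i j) x ∧
      ContDiffAt ℝ n (fun y => (ψ y).2.1 i j) x) :
    ContDiffAt ℝ n (fun y => pairMat (ψ y)) x :=
  (contDiffAt_mat fun i j => (h i j).1).prodMk (contDiffAt_mat fun i j => (h i j).2)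

theorem contDiffAt_entry {n : WithTop ℕ∞} {ψ : E → SLxSL} {x : E}
    (h : ContDiffAt ℝ n (fun y => pairMat (ψ y)) x) (i j : Fin 2) :
    ContDiffAt ℝ n (fun y => (ψ y).1.1 i j) x ∧ ContDiffAt ℝ n (fun y => (ψ y).2.1 i j) x :=
  ⟨((entryL i j).comp (ContinuousLinearMap.fst ℝ Mat Mat)).contDiff.contDiffAt.comp x h,
    ((entryL i j).comp (ContinuousLinearMap.snd ℝ Mat Mat)).contDiff.contDiffAt.comp x h⟩

theorem pairMat_inv_eq (x : SLxSL) : pairMat x⁻¹ = Ring.inverse (pairMat x) := by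
  have := Ring.inverse_unit (⟨pairMat x, pairMat x⁻¹, pairMat_mul_inv x, pairMat_inv_mul x⟩ :
    (Mat × Mat)ˣ)
  exact this.symm

theorem contDiffAt_pairMat_inv {n : WithTop ℕ∞} {ψ : E → SLxSL} {x : E}
    (h : ContDiffAt ℝ n (fun y => pairMat (ψ y)) x) :
    ContDiffAt ℝ n (fun y => pairMat (ψ y)⁻¹) x := by
  simp only [pairMat_inv_eq]
  exact (contDiffAt_ringInverse ℝ (⟨pairMat (ψ x), pairMat (ψ x)⁻¹, pairMat_mul_inv _,
    pairMat_inv_mul _⟩ : (Mat × Mat)ˣ)).comp x h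

theorem matDeriv_eq_fderiv {f : E → Mat} {x : E} (h : DifferentiableAt ℝ f x) (v : E) :
    matDeriv 𝓘(ℝ, E) f x v = fderiv ℝ f x v := by
  ext i j
  have := ((entryL i j).hasFDerivAt.comp x h.hasFDerivAt).fderiv
  change mfderiv 𝓘(ℝ, E) 𝓘(ℝ, ℝ) (fun q => f q i j) x v = _
  rw [mfderiv_eq_fderiv]
  exact DFunLike.congr_fun this v

theorem diff_eq_fderiv {ψ : E → SLxSL} {x : E}
    (h : DifferentiableAt ℝ (fun y => pairMat (ψ y)) x) (v : E) :
    diff 𝓘(ℝ, E) ψ x v = pairMat (ψ x)⁻¹ * fderiv ℝ (fun y => pairMat (ψ y)) x v := by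
  have h₁ : HasFDerivAt (fun y => (ψ y).1.1) _ x :=
    (ContinuousLinearMap.fst ℝ Mat Mat).hasFDerivAt.comp x h.hasFDerivAt
  have h₂ : HasFDerivAt (fun y => (ψ y).2.1) _ x :=
    (ContinuousLinearMap.snd ℝ Mat Mat).hasFDerivAt.comp x h.hasFDerivAt
  change ((ψ x).1⁻¹.1 * matDeriv 𝓘(ℝ, E) (fun q => (ψ q).1.1) x v,
    (ψ x).2⁻¹.1 * matDeriv 𝓘(ℝ, E) (fun q => (ψ q).2.1) x v) = _
  rw [matDeriv_eq_fderiv h₁.differentiableAt, matDeriv_eq_fderiv h₂.differentiableAt,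
    h₁.fderiv, h₂.fderiv]
  rfl

theorem det_entries (A : SL(2, ℝ)) : A.1 0 0 * A.1 1 1 - A.1 0 1 * A.1 1 0 = 1 := by
  rw [← Matrix.det_fin_two, A.2]

/-- This is the derivative of det A = 1, written with the adjugate as inverse. -/
theorem trace_inv_mul_matDeriv {A : E → SL(2, ℝ)} {x : E}
    (h : ∀ i j, DifferentiableAt ℝ (fun y => (A y).1 i j) x) (v : E) :
    ((A x)⁻¹.1 * matDeriv 𝓘(ℝ, E) (fun y => (A y).1) x v).trace = 0 := by
  have hd := (((h 0 0).hasFDerivAt.mul (h 1 1).hasFDerivAt).sub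
    ((h 0 1).hasFDerivAt.mul (h 1 0).hasFDerivAt))
  have h1 := hd.unique ((hasFDerivAt_const (1 : ℝ) x).congr_of_eventuallyEq
    (Filter.Eventually.of_forall fun y => det_entries (A y)))
  have h2 := DFunLike.congr_fun h1 v
  simp only [add_apply, sub_apply, smul_apply, smul_eq_mul, zero_apply] at h2
  have hi : (A x)⁻¹.1 = !![(A x).1 1 1, -(A x).1 0 1; -(A x).1 1 0, (A x).1 0 0] := by
    rw [← Matrix.adjugate_fin_two]
    exact Matrix.SpecialLinearGroup.coe_inv _
  have hm : ∀ i j, matDeriv 𝓘(ℝ, E) (fun y => (A y).1) x v i j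
      = fderiv ℝ (fun y => (A y).1 i j) x v := fun i j => by
    change mfderiv 𝓘(ℝ, E) 𝓘(ℝ, ℝ) (fun y => (A y).1 i j) x v = _
    rw [mfderiv_eq_fderiv]
    rfl
  rw [hi, Matrix.trace_fin_two]
  simp only [Matrix.mul_apply, Fin.sum_univ_two, hm, Matrix.of_apply, Matrix.cons_val_zero,
    Matrix.cons_val_one, Matrix.cons_val', Matrix.cons_val_fin_one]
  linarith

theorem pairMat_translation (a b c : SL(2, ℝ)) (x : SLxSL) :
    pairMat (translation a b c x) = pairMat (a, b) * pairMat x * pairMat (c, c) := by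
  rw [← pairMat_mul, ← pairMat_mul]
  rfl

theorem isSmooth_iff {ψ : E → SLxSL} :
    IsSmooth 𝓘(ℝ, E) ψ ↔ ContDiff ℝ ∞ (fun y => pairMat (ψ y)) := by
  simp only [IsSmooth, contMDiff_iff_contDiff, contDiff_iff_contDiffAt]
  exact ⟨fun h x => contDiffAt_pairMat fun i j => ⟨(h i j).1 x, (h i j).2 x⟩,
    fun h i j => ⟨fun x => (contDiffAt_entry (h x) i j).1, fun x => (contDiffAt_entry (h x) i j).2⟩⟩

theorem isSmooth_translation {ψ : E → SLxSL} (h : IsSmooth 𝓘(ℝ, E) ψ) (a b c : SL(2, ℝ)) :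
    IsSmooth 𝓘(ℝ, E) fun y => translation a b c (ψ y) := by
  rw [isSmooth_iff] at h ⊢
  simp only [pairMat_translation]
  exact (contDiff_const.mul h).mul contDiff_const

theorem ip_conj (A : SL(2, ℝ)) (X Y : Mat) : ip (A⁻¹.1 * X * A.1) (A⁻¹.1 * Y * A.1) = ip X Y := by
  rw [mul_assoc, mul_assoc, ip_mul_left]
  have h := det_entries A
  have : ip (X * A.1) (Y * A.1) = (A.1 0 0 * A.1 1 1 - A.1 0 1 * A.1 1 0) * ip X Y := by
    simp only [ip, Matrix.mul_apply, Fin.sum_univ_two]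
    ring
  rw [this, h, one_mul]

theorem g_conj (c : SL(2, ℝ)) (x y : Mat × Mat) :
    g (pairMat (c, c)⁻¹ * x * pairMat (c, c)) (pairMat (c, c)⁻¹ * y * pairMat (c, c)) = g x y := by
  have h := ip_conj c
  simp only [g, pairMat, Prod.fst_mul, Prod.snd_mul, Prod.fst_inv, Prod.snd_inv, h]

/-- The left factors cancel and the right factor acts by conjugation. A common c on both components
is what lets g, which mixes α and β, be preserved through `g_conj`. -/
theorem diff_translation {ψ : E → SLxSL} {x : E}
    (h : DifferentiableAt ℝ (fun y => pairMat (ψ y)) x) (a b c : SL(2, ℝ)) (v : E) :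
    diff 𝓘(ℝ, E) (fun y => translation a b c (ψ y)) x v
      = pairMat (c, c)⁻¹ * diff 𝓘(ℝ, E) ψ x v * pairMat (c, c) := by
  have hd := ((h.hasFDerivAt.const_mul (pairMat (a, b))).mul_const' (pairMat (c, c))).congr_of_eventuallyEq
    (Filter.Eventually.of_forall fun y => pairMat_translation a b c (ψ y))
  rw [diff_eq_fderiv hd.differentiableAt, diff_eq_fderiv h, hd.fderiv]
  have : (translation a b c (ψ x))⁻¹ = (c, c)⁻¹ * (ψ x)⁻¹ * (a, b)⁻¹ := by
    rw [show translation a b c (ψ x) = (a, b) * ψ x * (c, c) from rfl, mul_inv_rev, mul_inv_rev,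
      mul_assoc]
  rw [this, pairMat_mul, pairMat_mul]
  change pairMat (c, c)⁻¹ * pairMat (ψ x)⁻¹ * pairMat (a, b)⁻¹ *
    (pairMat (a, b) * fderiv ℝ (fun y => pairMat (ψ y)) x v * pairMat (c, c)) = _
  have e := pairMat_inv_mul (a, b)
  generalize pairMat (a, b)⁻¹ = P at *
  rw [← mul_assoc, ← mul_assoc, mul_assoc _ P, e, mul_one, mul_assoc _ (pairMat (ψ x)⁻¹)]

theorem isIsometry_translation (a b c : SL(2, ℝ)) : IsIsometry (translation a b c) where
  smooth ψ h := isSmooth_translation h a b c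
  smooth_symm ψ h := isSmooth_translation h a⁻¹ b⁻¹ c⁻¹
  preserves ψ h τ v := by
    have hd := (isSmooth_iff.mp h).contDiffAt (x := τ) |>.differentiableAt (by simp)
    have e := diff_translation hd a b c v
    exact (congrArg₂ g e e).trans (g_conj c _ _)

/-- The left trivialized differential of a map from a vector space, as a family of continuous
linear maps. -/
noncomputable def diffL (ψ : E → SLxSL) (x : E) : E →L[ℝ] Mat × Mat :=
  (ContinuousLinearMap.mul ℝ (Mat × Mat) (pairMat (ψ x)⁻¹)).comp
    (fderiv ℝ (fun y => pairMat (ψ y)) x)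

theorem diffL_apply {ψ : E → SLxSL} {x : E}
    (h : DifferentiableAt ℝ (fun y => pairMat (ψ y)) x) (v : E) :
    diffL ψ x v = diff 𝓘(ℝ, E) ψ x v :=
  (diff_eq_fderiv h v).symm

theorem contDiffAt_diffL {ψ : E → SLxSL} {x : E}
    (h : ContDiffAt ℝ ∞ (fun y => pairMat (ψ y)) x) : ContDiffAt ℝ ∞ (diffL ψ) x :=
  ((ContinuousLinearMap.mul ℝ (Mat × Mat)).contDiff.contDiffAt.comp x
    (contDiffAt_pairMat_inv h)).clm_comp (h.fderiv_right (m := ∞) (by simp))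

theorem maurerCartan_diffL {ψ : E → SLxSL} {x : E}
    (h : ContDiffAt ℝ 2 (fun y => pairMat (ψ y)) x) (e f : E) :
    fderiv ℝ (diffL ψ) x e f - fderiv ℝ (diffL ψ) x f e
      = -(diffL ψ x e * diffL ψ x f - diffL ψ x f * diffL ψ x e) :=
  maurerCartan h ((contDiffAt_pairMat_inv h).differentiableAt (by simp))
    (Filter.Eventually.of_forall fun y => pairMat_inv_mul _) (pairMat_mul_inv _) e f

theorem trace_diff {ψ : E → SLxSL} {x : E}
    (h : ContDiffAt ℝ 1 (fun y => pairMat (ψ y)) x) (v : E) :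
    (diff 𝓘(ℝ, E) ψ x v).1.trace = 0 ∧ (diff 𝓘(ℝ, E) ψ x v).2.trace = 0 :=
  ⟨trace_inv_mul_matDeriv (fun i j => (contDiffAt_entry h i j).1.differentiableAt (by simp)) v,
    trace_inv_mul_matDeriv (fun i j => (contDiffAt_entry h i j).2.differentiableAt (by simp)) v⟩

end Maps

end NKSL2

/-! ### Passage between the surface and its charts; globalization by connectedness -/

namespace NKSL2

section Charts

attribute [local instance] Matrix.linftyOpNormedRing Matrix.linftyOpNormedAlgebra matTopology

variable {M : Type*} [TopologicalSpace M] [ChartedSpace Plane M] [IsManifold (𝓡 2) ∞ M]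

instance isManifold_one : IsManifold (𝓡 2) 1 M := IsManifold.of_le (n := ∞) (by simp)

theorem two_le_infty : (2 : WithTop ℕ∞) ≤ ∞ :=
  WithTop.coe_le_coe.mpr (le_top : (2 : ℕ∞) ≤ ⊤)

theorem matDeriv_eq_of_chart {f : M → Mat} {h : Plane → Mat} (p : M) {q : M}
    (hq : q ∈ (chartAt Plane p).source) (hf : ∀ᶠ r in 𝓝 q, f r = h (chartAt Plane p r))
    (hh : DifferentiableAt ℝ h (chartAt Plane p q)) (v : TangentSpace (𝓡 2) q) :
    matDeriv (𝓡 2) f q v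
      = fderiv ℝ h (chartAt Plane p q) (mfderiv (𝓡 2) (𝓡 2) (chartAt Plane p) q v) := by
  refine Eq.trans ?_ (matDeriv_eq_fderiv hh _)
  ext i j
  change mfderiv (𝓡 2) 𝓘(ℝ, ℝ) (fun r => f r i j) q v
    = mfderiv (𝓡 2) 𝓘(ℝ, ℝ) (fun y => h y i j) (chartAt Plane p q)
      (mfderiv (𝓡 2) (𝓡 2) (chartAt Plane p) q v)
  have e : (fun r => f r i j) =ᶠ[𝓝 q] (fun y => h y i j) ∘ chartAt Plane p :=
    hf.mono fun r hr => by simp [hr]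
  have hd : DifferentiableAt ℝ (fun y => h y i j) (chartAt Plane p q) :=
    (entryL i j).differentiableAt.comp _ hh
  rw [e.mfderiv_eq, mfderiv_comp (I' := 𝓡 2) q hd.mdifferentiableAt
    ((mdifferentiable_chart p).mdifferentiableAt hq)]
  rfl

theorem contDiffAt_pairMat_chart {F : M → SLxSL} (hF : IsSmooth (𝓡 2) F) (p : M) {y : Plane}
    (hy : y ∈ (chartAt Plane p).target) :
    ContDiffAt ℝ ∞ (fun y => pairMat (F ((chartAt Plane p).symm y))) y := by
  have hs : ContMDiffAt (𝓡 2) (𝓡 2) ∞ (chartAt Plane p).symm y :=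
    (contMDiffOn_chart_symm y hy).contMDiffAt ((chartAt Plane p).open_target.mem_nhds hy)
  exact contDiffAt_pairMat (ψ := fun y => F ((chartAt Plane p).symm y)) fun i j =>
    ⟨(((hF i j).1 _).comp y hs).contDiffAt, (((hF i j).2 _).comp y hs).contDiffAt⟩

theorem diff_eq_diffL {F : M → SLxSL} (hF : IsSmooth (𝓡 2) F) (p : M) {q : M}
    (hq : q ∈ (chartAt Plane p).source) (v : TangentSpace (𝓡 2) q) :
    diff (𝓡 2) F q v = diffL (fun y => F ((chartAt Plane p).symm y)) (chartAt Plane p q)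
      (mfderiv (𝓡 2) (𝓡 2) (chartAt Plane p) q v) := by
  have hd := (contDiffAt_pairMat_chart hF p ((chartAt Plane p).map_source hq)).differentiableAt
    (by simp)
  have h₁ : HasFDerivAt (fun y => (F ((chartAt Plane p).symm y)).1.1) _ (chartAt Plane p q) :=
    (ContinuousLinearMap.fst ℝ Mat Mat).hasFDerivAt.comp _ hd.hasFDerivAt
  have h₂ : HasFDerivAt (fun y => (F ((chartAt Plane p).symm y)).2.1) _ (chartAt Plane p q) :=
    (ContinuousLinearMap.snd ℝ Mat Mat).hasFDerivAt.comp _ hd.hasFDerivAt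
  have hev : ∀ᶠ r in 𝓝 q, (chartAt Plane p).symm (chartAt Plane p r) = r :=
    (chartAt Plane p).eventually_left_inverse hq
  change ((F q).1⁻¹.1 * matDeriv (𝓡 2) (fun r => (F r).1.1) q v,
    (F q).2⁻¹.1 * matDeriv (𝓡 2) (fun r => (F r).2.1) q v) = _
  rw [matDeriv_eq_of_chart p hq (hev.mono fun r hr => by simp only [hr]) h₁.differentiableAt,
    matDeriv_eq_of_chart p hq (hev.mono fun r hr => by simp only [hr]) h₂.differentiableAt,
    h₁.fderiv, h₂.fderiv, diffL, (chartAt Plane p).left_inv hq]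
  rfl

theorem mfderiv_chart_bijective (p : M) {q : M} (hq : q ∈ (chartAt Plane p).source) :
    Function.Bijective (mfderiv (𝓡 2) (𝓡 2) (chartAt Plane p) q) :=
  (mdifferentiable_chart p).mfderiv_bijective hq

/-- In a chart, the vanishing of the second fundamental form says that the family of tangent
planes is autoparallel. -/
theorem IsTotallyGeodesic.chart {F : M → SLxSL} (hgeo : IsTotallyGeodesic F)
    (hF : IsSmooth (𝓡 2) F) (p : M) {q : M} (hq : q ∈ (chartAt Plane p).source) (e f : Plane) :
    ∃ w, fderiv ℝ (diffL fun y => F ((chartAt Plane p).symm y)) (chartAt Plane p q) e f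
      + nabla (diffL (fun y => F ((chartAt Plane p).symm y)) (chartAt Plane p q) e)
        (diffL (fun y => F ((chartAt Plane p).symm y)) (chartAt Plane p q) f)
      = diffL (fun y => F ((chartAt Plane p).symm y)) (chartAt Plane p q) w := by
  set φ := chartAt Plane p
  set X := diffL fun y => F (φ.symm y)
  have hinv : ∀ r ∈ φ.source, (mfderiv (𝓡 2) (𝓡 2) φ r).IsInvertible := fun r hr =>
    ⟨(mdifferentiable_chart p).mfderiv hr, rfl⟩
  -- The second fundamental form is tested on the pullback of a constant field of the chart, for
  -- which dF(Y) becomes X f.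
  set Y : (r : M) → TangentSpace (𝓡 2) r :=
    VectorField.mpullback (𝓡 2) (𝓡 2) φ (fun _ => (f : Plane))
  have hYf : ∀ r ∈ φ.source, mfderiv (𝓡 2) (𝓡 2) φ r (Y r) = f := fun r hr =>
    (hinv r hr).self_apply_inverse _
  have hYs : ContMDiffAt (𝓡 2) (𝓡 2).tangent ∞
      (fun r => (⟨r, Y r⟩ : TangentBundle (𝓡 2) M)) q := by
    refine ContMDiffAt.mpullback_vectorField_preimage (n := ∞) ?_
      ((contMDiffOn_chart q hq).contMDiffAt (φ.open_source.mem_nhds hq)) (hinv q hq) (by simp)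
    exact contMDiffAt_vectorSpace_iff_contDiffAt.mpr contDiffAt_const
  obtain ⟨v, hv⟩ := (mfderiv_chart_bijective p hq).2 e
  obtain ⟨w, hw⟩ := hgeo q Y hYs v
  refine ⟨mfderiv (𝓡 2) (𝓡 2) φ q w, ?_⟩
  have hX : DifferentiableAt ℝ X (φ q) :=
    (contDiffAt_diffL (contDiffAt_pairMat_chart hF p (φ.map_source hq))).differentiableAt (by simp)
  have hXf := hX.hasFDerivAt.clm_apply (hasFDerivAt_const f (φ q))
  have h₁ : HasFDerivAt (fun y => (X y f).1) _ (φ q) :=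
    (ContinuousLinearMap.fst ℝ Mat Mat).hasFDerivAt.comp _ hXf
  have h₂ : HasFDerivAt (fun y => (X y f).2) _ (φ q) :=
    (ContinuousLinearMap.snd ℝ Mat Mat).hasFDerivAt.comp _ hXf
  have hdF : ∀ r ∈ φ.source, diff (𝓡 2) F r (Y r) = X (φ r) f := fun r hr => by
    rw [diff_eq_diffL hF p hr, hYf r hr]
  have hev : ∀ᶠ r in 𝓝 q, diff (𝓡 2) F r (Y r) = X (φ r) f :=
    Filter.mem_of_superset (φ.open_source.mem_nhds hq) hdF
  rw [← diff_eq_diffL hF p hq, ← hw, covDeriv,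
    matDeriv_eq_of_chart p hq (hev.mono fun r hr => by rw [hr]) h₁.differentiableAt,
    matDeriv_eq_of_chart p hq (hev.mono fun r hr => by rw [hr]) h₂.differentiableAt,
    h₁.fderiv, h₂.fderiv, hdF q hq, diff_eq_diffL hF p hq, hv]
  congr 1
  ext1 <;> simp

/-- The left trivialized tangent planes of the surface are locally constant. -/
theorem eventually_diff_mem_unitPlane {F : M → SLxSL} (hF : IsAlmostComplexSurface F)
    (hneg : IsNegDefSurface F) (hgeo : IsTotallyGeodesic F) (p : M) :
    ∃ ε : Mat, ε.trace = 0 ∧ ip ε ε = -1 ∧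
      ∀ᶠ q in 𝓝 p, ∀ v, diff (𝓡 2) F q v ∈ unitPlane ε := by
  set φ := chartAt Plane p with hφ
  have hp : p ∈ φ.source := mem_chart_source Plane p
  set X := diffL fun y => F (φ.symm y) with hX
  have hmem : ∀ᶠ y in 𝓝 (φ p), y ∈ φ.target := φ.open_target.mem_nhds (φ.map_source hp)
  have key : ∀ y ∈ φ.target, ∃ q ∈ φ.source, φ q = y := fun y hy =>
    ⟨φ.symm y, φ.map_target hy, φ.right_inv hy⟩
  have hev : ∀ {P : Plane → Prop}, (∀ q ∈ φ.source, P (φ q)) → ∀ᶠ y in 𝓝 (φ p), P y := by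
    intro P h
    filter_upwards [hmem] with y hy
    obtain ⟨q, hq, rfl⟩ := key y hy
    exact h q hq
  have hsm : ∀ q ∈ φ.source, ContDiffAt ℝ ∞ (fun y => pairMat (F (φ.symm y))) (φ q) :=
    fun q hq => contDiffAt_pairMat_chart hF.smooth p (φ.map_source hq)
  have hval : ∀ q ∈ φ.source, ∀ v, X (φ q) (mfderiv (𝓡 2) (𝓡 2) φ q v) = diff (𝓡 2) F q v :=
    fun q hq v => (diff_eq_diffL hF.smooth p hq v).symm
  obtain ⟨ε, h₁, h₂, h₃⟩ := eventually_mem_unitPlane (X := X) (x := φ p)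
    (hev fun q hq => (contDiffAt_diffL (hsm q hq)).of_le two_le_infty)
    (hev fun q hq e => by
      rw [hX, diffL_apply ((hsm q hq).differentiableAt (by simp))]
      exact trace_diff ((hsm q hq).of_le (by simp)) e)
    (hev fun q hq => by
      intro e f hef
      obtain ⟨v, rfl⟩ := (mfderiv_chart_bijective p hq).2 e
      obtain ⟨w, rfl⟩ := (mfderiv_chart_bijective p hq).2 f
      rw [hval q hq, hval q hq] at hef
      rw [hF.immersion q hef])
    (hev fun q hq e => by
      obtain ⟨v, rfl⟩ := (mfderiv_chart_bijective p hq).2 e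
      obtain ⟨w, hw⟩ := hF.invariant q v
      refine ⟨mfderiv (𝓡 2) (𝓡 2) φ q w, ?_⟩
      exact (congrArg J (hval q hq v)).trans (hw.trans (hval q hq w).symm))
    (hev fun q hq e he => by
      obtain ⟨v, rfl⟩ := (mfderiv_chart_bijective p hq).2 e
      rw [hval q hq]
      exact hneg q v fun h0 => he (by rw [h0, map_zero]; rfl))
    (hev fun q hq e f => maurerCartan_diffL ((hsm q hq).of_le two_le_infty) e f)
    (hev fun q hq e f => hgeo.chart hF.smooth p hq e f)
  refine ⟨ε, h₁, h₂, ?_⟩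
  filter_upwards [(φ.continuousAt hp).eventually h₃, φ.open_source.mem_nhds hp] with q hq hq' v
  rw [← hval q hq']
  exact hq _

theorem exists_diff_mem_unitPlane [ConnectedSpace M] {F : M → SLxSL}
    (hF : IsAlmostComplexSurface F)
    (hneg : IsNegDefSurface F) (hgeo : IsTotallyGeodesic F) :
    ∃ ε : Mat, ε.trace = 0 ∧ ip ε ε = -1 ∧ ∀ q v, diff (𝓡 2) F q v ∈ unitPlane ε := by
  obtain ⟨p₀⟩ : Nonempty M := inferInstance
  obtain ⟨ε, h₁, h₂, h₃⟩ := eventually_diff_mem_unitPlane hF hneg hgeo p₀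
  refine ⟨ε, h₁, h₂, ?_⟩
  set S := {q : M | ∀ v, diff (𝓡 2) F q v ∈ unitPlane ε}
  -- Near p the planes lie in one `unitPlane δ`. If δ is proportional to ε, every nearby point is in
  -- S; if not, the two product planes meet only in 0 and none is. So S is clopen.
  have hloc : ∀ p : M, (∀ᶠ q in 𝓝 p, q ∈ S) ∨ ∀ᶠ q in 𝓝 p, q ∉ S := by
    intro p
    obtain ⟨δ, k₁, k₂, k₃⟩ := eventually_diff_mem_unitPlane hF hneg hgeo p
    by_cases h : ∃ t : ℝ, t ≠ 0 ∧ δ = t • ε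
    · left
      obtain ⟨t, ht, rfl⟩ := h
      filter_upwards [k₃] with q hq v
      obtain ⟨a, b, hab⟩ := mem_unitPlane.mp (hq v)
      rw [hab, smul_smul, smul_smul]
      exact mem_unitPlane.mpr ⟨_, _, rfl⟩
    · right
      filter_upwards [k₃] with q hq hS
      apply h
      obtain ⟨v, hv⟩ := exists_ne (0 : Plane)
      obtain ⟨a, b, hab⟩ := mem_unitPlane.mp (hq v)
      obtain ⟨c, d, hcd⟩ := mem_unitPlane.mp (hS v)
      have hne : diff (𝓡 2) F q v ≠ 0 := fun h0 => by
        have := hneg q v hv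
        rw [h0] at this
        simp [g, ip] at this
      have hδ : δ ≠ 0 := by rintro rfl; simp [ip] at k₂
      have aux : ∀ s t : ℝ, s ≠ 0 → s • δ = t • ε → ∃ t : ℝ, t ≠ 0 ∧ δ = t • ε := by
        intro s t hs hst
        refine ⟨s⁻¹ * t, ?_, by rw [mul_smul, ← hst, smul_smul, inv_mul_cancel₀ hs, one_smul]⟩
        intro h0
        have : t = 0 := (mul_eq_zero.mp h0).resolve_left (inv_ne_zero hs)
        rw [this, zero_smul] at hst
        exact (smul_ne_zero hs hδ) hst
      have e := hab.symm.trans hcd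
      rw [Prod.mk.injEq] at e
      by_cases ha : a = 0
      · have hb : b ≠ 0 := by
          rintro rfl
          exact hne (by rw [hab, ha]; simp)
        exact aux b d hb e.2
      · exact aux a c ha e.1
  have hclopen : IsClopen S := by
    constructor
    · rw [← isOpen_compl_iff, isOpen_iff_mem_nhds]
      intro p hp
      exact (hloc p).resolve_left fun h => hp h.self_of_nhds
    · rw [isOpen_iff_mem_nhds]
      intro p hp
      exact (hloc p).resolve_right fun h => h.self_of_nhds hp
  have huniv : S = Set.univ := hclopen.eq_univ ⟨p₀, h₃.self_of_nhds⟩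
  exact Set.eq_univ_iff_forall.mp huniv

/-- If the tangent planes are left translates of `unitPlane ε`, then the conjugates of `ε` by the
components of `F` are constant. -/
theorem conj_eq_of_diff_mem_unitPlane [ConnectedSpace M] {F : M → SLxSL}
    (hF : IsSmooth (𝓡 2) F) {ε : Mat}
    (h : ∀ q v, diff (𝓡 2) F q v ∈ unitPlane ε) (p q : M) :
    pairMat (F p) * (ε, ε) * pairMat (F p)⁻¹ = pairMat (F q) * (ε, ε) * pairMat (F q)⁻¹ := by
  have hlc : IsLocallyConstant fun q => pairMat (F q) * (ε, ε) * pairMat (F q)⁻¹ := by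
    rw [IsLocallyConstant.iff_eventually_eq]
    intro p
    set φ := chartAt Plane p with hφ
    have hp : p ∈ φ.source := mem_chart_source Plane p
    have hmem : ∀ᶠ y in 𝓝 (φ p), y ∈ φ.target := φ.open_target.mem_nhds (φ.map_source hp)
    have hc : ∀ᶠ y in 𝓝 (φ p), (fun y => pairMat (F (φ.symm y)) * (ε, ε) * pairMat (F (φ.symm y))⁻¹) y
        = (fun y => pairMat (F (φ.symm y)) * (ε, ε) * pairMat (F (φ.symm y))⁻¹) (φ p) := by
      apply eventually_eq_of_fderiv_eq_zero
      filter_upwards [hmem] with y hy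
      have hs := contDiffAt_pairMat_chart hF p hy
      have hd := (hs.differentiableAt (by simp)).hasFDerivAt
      have hd' := ((contDiffAt_pairMat_inv hs).differentiableAt (by simp)).hasFDerivAt
      have hinv := fun v => DFunLike.congr_fun ((hd'.mul' hd).unique
        ((hasFDerivAt_const (1 : Mat × Mat) y).congr_of_eventuallyEq
          (Filter.Eventually.of_forall fun z => pairMat_inv_mul (F (φ.symm z))))) v
      have hC := (hd.mul_const' (ε, ε)).mul' hd'
      refine ⟨hC.differentiableAt, hC.fderiv.trans ?_⟩
      ext1 v
      have hv := hinv v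
      have hX : diffL (fun y => F (φ.symm y)) y v ∈ unitPlane ε := by
        obtain ⟨q, hq, rfl⟩ : ∃ q ∈ φ.source, φ q = y := ⟨φ.symm y, φ.map_target hy, φ.right_inv hy⟩
        obtain ⟨w, rfl⟩ := (mfderiv_chart_bijective p hq).2 v
        rw [← diff_eq_diffL hF p hq]
        exact h q w
      -- With X = G⁻¹ dG, the derivative of G(ε, ε)G⁻¹ is G[X, (ε, ε)]G⁻¹, which vanishes because X
      -- has components in ℝε.
      have hcomm : diffL (fun y => F (φ.symm y)) y v * (ε, ε)
          = (ε, ε) * diffL (fun y => F (φ.symm y)) y v := by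
        obtain ⟨a, b, hab⟩ := mem_unitPlane.mp hX
        rw [hab, Prod.mk_mul_mk, Prod.mk_mul_mk]
        simp
      simp only [add_apply, smul_apply, zero_apply] at hv ⊢
      change pairMat (F (φ.symm y))⁻¹ * fderiv ℝ (fun y => pairMat (F (φ.symm y))) y v
        + fderiv ℝ (fun y => pairMat (F (φ.symm y))⁻¹) y v * pairMat (F (φ.symm y)) = 0 at hv
      change pairMat (F (φ.symm y)) * (ε, ε) * fderiv ℝ (fun y => pairMat (F (φ.symm y))⁻¹) y v
        + fderiv ℝ (fun y => pairMat (F (φ.symm y))) y v * (ε, ε) * pairMat (F (φ.symm y))⁻¹ = 0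
      have hXe : diffL (fun y => F (φ.symm y)) y v
        = pairMat (F (φ.symm y))⁻¹ * fderiv ℝ (fun y => pairMat (F (φ.symm y))) y v := rfl
      rw [hXe] at hcomm
      have i₁ := pairMat_inv_mul (F (φ.symm y))
      have i₂ := pairMat_mul_inv (F (φ.symm y))
      generalize fderiv ℝ (fun y => pairMat (F (φ.symm y))) y v = dG at *
      generalize fderiv ℝ (fun y => pairMat (F (φ.symm y))⁻¹) y v = dGi at *
      generalize pairMat (F (φ.symm y)) = G at *
      generalize pairMat (F (φ.symm y))⁻¹ = Gi at *
      have e₁ : dGi = -(Gi * dG) * Gi := by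
        rw [← eq_neg_of_add_eq_zero_right hv, mul_assoc, i₂, mul_one]
      have e₂ : dG = G * (Gi * dG) := by rw [← mul_assoc, i₂, one_mul]
      rw [e₁, e₂, ← mul_assoc Gi G, i₁, one_mul]
      have : G * (Gi * dG) * (ε, ε) * Gi = G * ((Gi * dG) * (ε, ε)) * Gi := by noncomm_ring
      rw [this, hcomm]
      noncomm_ring
    filter_upwards [(φ.continuousAt hp).eventually hc, φ.open_source.mem_nhds hp] with r hr hr'
    simpa only [φ.left_inv hr', φ.left_inv hp] using hr
  exact hlc.apply_eq_of_isPreconnected isPreconnected_univ (Set.mem_univ p) (Set.mem_univ q)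

end Charts

end NKSL2

namespace NKSL2

/-! ### Rotations -/

/-- The generator of the rotation group. -/
def rotGen : Mat := !![0, 1; -1, 0]

/-- A time-like unit vector of `sl(2,ℝ)` is conjugate to the generator of the rotations, up to
sign. -/
theorem exists_conj_rotGen {ε : Mat} (h₁ : ε.trace = 0) (h₂ : ip ε ε = -1) :
    ∃ (c : SL(2, ℝ)) (σ : ℝ), σ ≠ 0 ∧ ε * c.1 = σ • (c.1 * rotGen) := by
  have a := trace_zero_apply h₁
  have hdet : ε 0 0 ^ 2 + ε 0 1 * ε 1 0 = -1 := by
    rw [← h₂, ip, a]; ring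
  have hb : ε 0 1 ≠ 0 := by
    intro h
    rw [h] at hdet
    nlinarith [sq_nonneg (ε 0 0)]
  -- The sign is unavoidable, as the rotation generator and its negative are not conjugate in
  -- SL(2,ℝ). It is harmless, because only centralizers are used later.
  obtain ⟨σ, hσ, hpos⟩ : ∃ σ : ℝ, σ * σ = 1 ∧ 0 < σ * ε 0 1 := by
    rcases lt_or_gt_of_ne hb with h | h
    · exact ⟨-1, by norm_num, by linarith⟩
    · exact ⟨1, by norm_num, by linarith⟩
  obtain ⟨y, hy⟩ : ∃ y : ℝ, σ * ε 0 1 * (y * y) = 1 := by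
    refine ⟨(√(σ * ε 0 1))⁻¹, ?_⟩
    rw [← mul_inv, Real.mul_self_sqrt hpos.le, mul_inv_cancel₀ hpos.ne']
  -- The first column is v = (0, y) and the second is -σεv, as the conjugation equation demands; y
  -- normalizes the determinant σ ε₀₁ y² to 1.
  refine ⟨⟨!![0, -(σ * ε 0 1 * y); y, σ * ε 0 0 * y], ?_⟩, σ, ?_, ?_⟩
  · rw [Matrix.det_fin_two_of]; linarith
  · rintro rfl; simp at hσ
  · ext i j
    fin_cases i <;> fin_cases j <;>
      simp [Matrix.mul_apply, Fin.sum_univ_two, rotGen, a]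
    · linear_combination (-ε 0 1 * y) * hσ
    · ring
    · linear_combination (-ε 0 0 * y) * hσ
    · linear_combination (-σ * y) * hdet

theorem apply_of_commute_rotGen {A : SL(2, ℝ)} (h : A.1 * rotGen = rotGen * A.1) :
    A.1 1 1 = A.1 0 0 ∧ A.1 1 0 = -A.1 0 1 ∧ A.1 0 0 ^ 2 + A.1 0 1 ^ 2 = 1 := by
  have e : ∀ i j, (A.1 * rotGen) i j = (rotGen * A.1) i j := fun i j => by rw [h]
  have e01 := e 0 1
  have e00 := e 0 0
  simp [rotGen, Matrix.mul_apply, Fin.sum_univ_two] at e01 e00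
  have hd := det_entries A
  rw [← e01, ← e00] at hd
  exact ⟨e01.symm, e00.symm, by linarith⟩

theorem eq_rot_of_commute_rotGen {A : SL(2, ℝ)} (h : A.1 * rotGen = rotGen * A.1) {u : ℝ}
    (hc : Real.cos u = A.1 0 0) (hs : Real.sin u = A.1 0 1) : A = rot u := by
  obtain ⟨h₁, h₂, -⟩ := apply_of_commute_rotGen h
  ext i j
  fin_cases i <;> fin_cases j <;> simp [rot, h₁, h₂, hc, hs]

theorem exists_cos_sin {x y : ℝ} (h : x ^ 2 + y ^ 2 = 1) :
    ∃ u : ℝ, Real.cos u = x ∧ Real.sin u = y := by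
  have hn : ‖(⟨x, y⟩ : ℂ)‖ = 1 := by
    rw [Complex.norm_def, Complex.normSq_mk, Real.sqrt_eq_one]
    linarith
  have h0 : (⟨x, y⟩ : ℂ) ≠ 0 := fun h => by rw [h] at hn; simp at hn
  refine ⟨Complex.arg ⟨x, y⟩, ?_, ?_⟩
  · rw [Complex.cos_arg h0, hn, div_one]
  · rw [Complex.sin_arg, hn, div_one]

/-- A smooth map into the rotation group has locally a smooth angle. -/
theorem exists_local_angle {E : Type*} [NormedAddCommGroup E] [NormedSpace ℝ E]
    {A : E → SL(2, ℝ)} {x : E}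
    (hA : ∀ᶠ y in 𝓝 x, ∀ i j, ContDiffAt ℝ ∞ (fun z => (A z).1 i j) y)
    (h : ∀ y, (A y).1 * rotGen = rotGen * (A y).1) :
    ∃ u : E → ℝ, ∀ᶠ y in 𝓝 x, ContDiffAt ℝ ∞ u y ∧ A y = rot (u y) := by
  have hsq := fun y => (apply_of_commute_rotGen (h y)).2.2
  obtain ⟨u₀, hc, hs⟩ := exists_cos_sin (hsq x)
  -- S and C are the sine and cosine of the angle measured from u₀. Near x the cosine is positive,
  -- so arcsine gives the angle smoothly.
  set S : E → ℝ := fun y => (A y).1 0 1 * Real.cos u₀ - (A y).1 0 0 * Real.sin u₀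
  set C : E → ℝ := fun y => (A y).1 0 0 * Real.cos u₀ + (A y).1 0 1 * Real.sin u₀
  have hSC : ∀ y, S y ^ 2 + C y ^ 2 = 1 := by
    intro y
    have h1 := Real.sin_sq_add_cos_sq u₀
    have : S y ^ 2 + C y ^ 2 = ((A y).1 0 0 ^ 2 + (A y).1 0 1 ^ 2)
        * (Real.sin u₀ ^ 2 + Real.cos u₀ ^ 2) := by
      simp only [S, C]; ring
    rw [this, h1, hsq y, one_mul]
  have hCx : 0 < C x := by
    have : C x = 1 := by simp only [C, hc, hs]; linarith [hsq x]
    rw [this]; exact one_pos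
  have hcont : ContinuousAt C x :=
    ((hA.self_of_nhds 0 0).continuousAt.mul continuousAt_const).add
      ((hA.self_of_nhds 0 1).continuousAt.mul continuousAt_const)
  refine ⟨fun y => u₀ + Real.arcsin (S y), ?_⟩
  filter_upwards [hA, hcont.eventually (eventually_gt_nhds hCx)] with y hy hCy
  have hlt : S y ^ 2 < 1 := by nlinarith [hSC y]
  have hlt' := abs_lt.mp ((sq_lt_one_iff_abs_lt_one _).mp hlt)
  have hsin : Real.sin (Real.arcsin (S y)) = S y := Real.sin_arcsin hlt'.1.le hlt'.2.le
  have hcos : Real.cos (Real.arcsin (S y)) = C y := by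
    rw [Real.cos_arcsin, show 1 - S y ^ 2 = C y ^ 2 by linarith [hSC y], Real.sqrt_sq hCy.le]
  refine ⟨contDiffAt_const.add (ContDiffAt.comp (g := Real.arcsin) (f := S) y
    (Real.contDiffAt_arcsin hlt'.1.ne' hlt'.2.ne)
    (((hy 0 1).mul contDiffAt_const).sub ((hy 0 0).mul contDiffAt_const))), ?_⟩
  have h1 := Real.sin_sq_add_cos_sq u₀
  apply eq_rot_of_commute_rotGen (h y)
  · rw [Real.cos_add, hsin, hcos]
    simp only [S, C]
    linear_combination (A y).1 0 0 * h1
  · rw [Real.sin_add, hsin, hcos]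
    simp only [S, C]
    linear_combination (A y).1 0 1 * h1

theorem model_eq (u w : ℝ) :
    model (√2 / (2 * √3) * (u + w)) (√2 / 2 * (w - u)) = (rot u, rot w) := by
  have h2 : √2 ≠ 0 := by positivity
  have h3 : √3 ≠ 0 := by positivity
  rw [model]
  congr 2 <;> field_simp <;> ring

/-! ### Local diffeomorphisms from the inverse function theorem -/

section InverseFunction

variable {E : Type*} [NormedAddCommGroup E] [NormedSpace ℝ E] [FiniteDimensional ℝ E]

/-- A smooth map with injective derivatives between open sets of a vector space is a local
diffeomorphism. -/
theorem exists_openPartialHomeomorph {f : E → E} {x : E}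
    (hf : ∀ᶠ y in 𝓝 x, ContDiffAt ℝ ∞ f y ∧ Function.Injective (fderiv ℝ f y)) {U : Set E}
    (hU : U ∈ 𝓝 x) :
    ∃ e : OpenPartialHomeomorph E E, x ∈ e.source ∧ e.source ⊆ U ∧ (∀ y, e y = f y) ∧
      ContDiffOn ℝ ∞ e e.source ∧ ContDiffOn ℝ ∞ e.symm e.target := by
  have : CompleteSpace E := FiniteDimensional.complete ℝ E
  obtain ⟨V, hV, hVo, hxV⟩ := mem_nhds_iff.mp (Filter.inter_mem hf hU)
  -- Invertibility is needed on all of V, not only at x, to have the inverse smooth on the whole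
  -- target.
  have heq : ∀ y ∈ V, ∃ f' : E ≃L[ℝ] E, HasFDerivAt f (f' : E →L[ℝ] E) y := by
    intro y hy
    obtain ⟨⟨h1, h2⟩, -⟩ := hV hy
    refine ⟨(LinearEquiv.ofInjectiveEndo (fderiv ℝ f y : E →ₗ[ℝ] E) h2).toContinuousLinearEquiv, ?_⟩
    convert! (h1.differentiableAt (by simp)).hasFDerivAt using 1
  obtain ⟨f', hf'⟩ := heq x hxV
  have hfx : ContDiffAt ℝ ∞ f x := (hV hxV).1.1
  refine ⟨(hfx.toOpenPartialHomeomorph f hf' (by simp)).restrOpen V hVo, ?_, ?_, fun y => rfl,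
    ?_, ?_⟩
  · exact ⟨hfx.mem_toOpenPartialHomeomorph_source hf' (by simp), hxV⟩
  · exact fun y hy => (hV hy.2).2
  · exact fun y hy => (hV hy.2).1.1.contDiffWithinAt
  · intro z hz
    set e := (hfx.toOpenPartialHomeomorph f hf' (by simp)).restrOpen V hVo
    have hy : e.symm z ∈ V := (e.map_target hz).2
    obtain ⟨g', hg'⟩ := heq _ hy
    exact (e.contDiffAt_symm hz hg' (hV hy).1.1).contDiffWithinAt

end InverseFunction

/-! ### Reduction to rotations and construction of the coordinates -/

section Surface

attribute [local instance] Matrix.linftyOpNormedRing Matrix.linftyOpNormedAlgebra matTopology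

variable {M : Type*} [TopologicalSpace M] [ChartedSpace Plane M] [IsManifold (𝓡 2) ∞ M]

theorem contDiff_model : ContDiff ℝ ∞ fun z : Plane => pairMat (model (z 0) (z 1)) := by
  have h0 : ContDiff ℝ ∞ fun z : Plane => z 0 := contDiff_piLp_apply (p := 2)
  have h1 : ContDiff ℝ ∞ fun z : Plane => z 1 := contDiff_piLp_apply (p := 2)
  have hrot : ∀ u : Plane → ℝ, ContDiff ℝ ∞ u → ∀ i j,
      ContDiff ℝ ∞ fun z => (rot (u z)).1 i j := by
    intro u hu i j
    fin_cases i <;> fin_cases j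
    · exact Real.contDiff_cos.comp hu
    · exact Real.contDiff_sin.comp hu
    · exact (Real.contDiff_sin.comp hu).neg
    · exact Real.contDiff_cos.comp hu
  rw [contDiff_iff_contDiffAt]
  exact fun z => contDiffAt_pairMat fun i j =>
    ⟨(hrot _ (contDiff_const.mul ((contDiff_const.mul h0).sub h1)) i j).contDiffAt,
      (hrot _ (contDiff_const.mul ((contDiff_const.mul h0).add h1)) i j).contDiffAt⟩

/-- Equality of the two conjugates of e says that G₀⁻¹G centralizes e; conjugating by c carries this
to the centralizer of j, where the scalar σ cancels. -/
theorem commute_of_conj_eq {G₀ G c ci Gi₀ Gi e j : Mat × Mat} {σ : ℝ} (hσ : σ ≠ 0)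
    (h : G * e * Gi = G₀ * e * Gi₀) (h₁ : Gi₀ * G₀ = 1) (h₂ : Gi * G = 1) (h₃ : ci * c = 1)
    (h₄ : c * ci = 1) (he : e * c = σ • (c * j)) :
    (ci * Gi₀) * G * c * j = j * ((ci * Gi₀) * G * c) := by
  have hD : Gi₀ * G * e = e * (Gi₀ * G) := by
    calc Gi₀ * G * e = Gi₀ * (G * e * Gi) * G := by
          simp only [mul_assoc, h₂, mul_one]
      _ = e * (Gi₀ * G) := by rw [h]; simp only [← mul_assoc, h₁, one_mul]
  have hj : σ • (ci * (Gi₀ * G) * c * j) = σ • (j * (ci * (Gi₀ * G) * c)) := by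
    calc σ • (ci * (Gi₀ * G) * c * j) = ci * (Gi₀ * G) * (σ • (c * j)) := by
          simp only [mul_assoc, mul_smul_comm]
      _ = ci * (Gi₀ * G * e) * c := by rw [← he]; simp only [mul_assoc]
      _ = ci * (e * c) * ci * (Gi₀ * G) * c := by
          rw [hD]
          simp only [mul_assoc]
          rw [← mul_assoc c ci, h₄, one_mul]
      _ = σ • (j * (ci * (Gi₀ * G) * c)) := by
          rw [he]
          simp only [mul_smul_comm, smul_mul_assoc, ← mul_assoc, h₃, one_mul]
  have := smul_right_injective _ hσ hj
  simpa only [mul_assoc] using this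

/-- After a translation the surface lies in the product of the rotation groups. -/
theorem exists_translation_commute [ConnectedSpace M] {F : M → SLxSL}
    (hF : IsAlmostComplexSurface F) (hneg : IsNegDefSurface F) (hgeo : IsTotallyGeodesic F) :
    ∃ a b c : SL(2, ℝ), ∀ q,
      (translation a b c (F q)).1.1 * rotGen = rotGen * (translation a b c (F q)).1.1 ∧
      (translation a b c (F q)).2.1 * rotGen = rotGen * (translation a b c (F q)).2.1 := by
  obtain ⟨ε, h₁, h₂, hε⟩ := exists_diff_mem_unitPlane hF hneg hgeo
  obtain ⟨c, σ, hσ, hc⟩ := exists_conj_rotGen h₁ h₂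
  obtain ⟨p⟩ : Nonempty M := inferInstance
  -- This normalization sends the base point F p to the identity.
  refine ⟨c⁻¹ * (F p).1⁻¹, c⁻¹ * (F p).2⁻¹, c, fun q => ?_⟩
  have h := commute_of_conj_eq (c := pairMat (c, c)) (ci := pairMat (c, c)⁻¹) (e := (ε, ε))
    (j := (rotGen, rotGen)) hσ (conj_eq_of_diff_mem_unitPlane hF.smooth hε q p)
    (pairMat_inv_mul _) (pairMat_inv_mul _) (pairMat_inv_mul _) (pairMat_mul_inv _)
    (Prod.ext hc hc)
  rw [← pairMat_mul] at h
  have ht : pairMat ((c, c)⁻¹ * (F p)⁻¹) * pairMat (F q) * pairMat (c, c)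
      = pairMat (translation (c⁻¹ * (F p).1⁻¹) (c⁻¹ * (F p).2⁻¹) c (F q)) := by
    rw [pairMat_translation]
    rfl
  rw [ht] at h
  exact Prod.ext_iff.mp h

theorem exists_coordinates {F : M → SLxSL} (hF : IsAlmostComplexSurface F) {a b c : SL(2, ℝ)}
    (h : ∀ q, (translation a b c (F q)).1.1 * rotGen = rotGen * (translation a b c (F q)).1.1 ∧
      (translation a b c (F q)).2.1 * rotGen = rotGen * (translation a b c (F q)).2.1) (p : M) :
    ∃ φ ∈ IsManifold.maximalAtlas (𝓡 2) ∞ M, p ∈ φ.source ∧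
      ∀ q ∈ φ.source, translation a b c (F q) = model (φ q 0) (φ q 1) := by
  set φ := chartAt Plane p with hφ
  have hp : p ∈ φ.source := mem_chart_source Plane p
  have hmem : ∀ᶠ y in 𝓝 (φ p), y ∈ φ.target := φ.open_target.mem_nhds (φ.map_source hp)
  set ψ : Plane → SLxSL := fun y => F (φ.symm y) with hψ
  set ψ' : Plane → SLxSL := fun y => translation a b c (ψ y) with hψ'
  have hsm : ∀ y ∈ φ.target, ContDiffAt ℝ ∞ (fun y => pairMat (ψ y)) y := fun y hy =>
    contDiffAt_pairMat_chart hF.smooth p hy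
  have hsm' : ∀ y ∈ φ.target, ContDiffAt ℝ ∞ (fun y => pairMat (ψ' y)) y := by
    intro y hy
    simp only [hψ', pairMat_translation]
    exact (contDiffAt_const.mul (hsm y hy)).mul contDiffAt_const
  obtain ⟨u, hu⟩ := exists_local_angle (A := fun y => (ψ' y).1) (x := φ p)
    (hmem.mono fun y hy i j => (contDiffAt_entry (hsm' y hy) i j).1) fun y => (h _).1
  obtain ⟨w, hw⟩ := exists_local_angle (A := fun y => (ψ' y).2) (x := φ p)
    (hmem.mono fun y hy i j => (contDiffAt_entry (hsm' y hy) i j).2) fun y => (h _).2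
  -- These are s and t solved from u = (√3 s - t)/√2 and w = (√3 s + t)/√2.
  set Θ : Plane → Plane := fun y => !₂[√2 / (2 * √3) * (u y + w y), √2 / 2 * (w y - u y)] with hΘ
  have hmodel : ∀ᶠ y in 𝓝 (φ p), ψ' y = model (Θ y 0) (Θ y 1) := by
    filter_upwards [hu, hw] with y hy hy'
    have : model (Θ y 0) (Θ y 1) = (rot (u y), rot (w y)) := model_eq (u y) (w y)
    rw [this, ← hy.2, ← hy'.2]
  have hΘs : ∀ᶠ y in 𝓝 (φ p), ContDiffAt ℝ ∞ Θ y := by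
    filter_upwards [hu, hw] with y hy hy'
    rw [contDiffAt_euclidean]
    intro i
    fin_cases i
    · exact contDiffAt_const.mul (hy.1.add hy'.1)
    · exact contDiffAt_const.mul (hy'.1.sub hy.1)
  -- The translated surface factors through Θ, so a vector killed by dΘ is killed by the
  -- differential of the translated map, hence by dF.
  have hinj : ∀ᶠ y in 𝓝 (φ p), Function.Injective (fderiv ℝ Θ y) := by
    filter_upwards [hmem, hΘs, eventually_eventually_nhds.mpr hmodel] with y hy hys hym
    rw [injective_iff_map_eq_zero]
    intro v hv
    have hcomp : HasFDerivAt (fun y => pairMat (ψ' y)) _ y :=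
      (((contDiff_model.differentiable (by simp)) (Θ y)).hasFDerivAt.comp y
        (hys.differentiableAt (by simp)).hasFDerivAt).congr_of_eventuallyEq
        (hym.mono fun z hz => by simp only [hz, Function.comp_apply])
    have hd : diff (𝓡 2) ψ' y v = 0 := by
      rw [diff_eq_fderiv hcomp.differentiableAt, hcomp.fderiv, ContinuousLinearMap.comp_apply, hv,
        map_zero, mul_zero]
    have hd' : diff (𝓡 2) ψ y v = 0 := by
      have e := diff_translation ((hsm y hy).differentiableAt (by simp)) a b c v
      rw [show diff 𝓘(ℝ, Plane) (fun y => translation a b c (ψ y)) y v = 0 from hd] at e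
      have e₁ := pairMat_mul_inv (c, c)
      calc diff (𝓡 2) ψ y v = (pairMat (c, c) * pairMat (c, c)⁻¹) * diff (𝓡 2) ψ y v
            * (pairMat (c, c) * pairMat (c, c)⁻¹) := by rw [e₁, one_mul, mul_one]
        _ = pairMat (c, c) * (pairMat (c, c)⁻¹ * diff (𝓡 2) ψ y v * pairMat (c, c))
            * pairMat (c, c)⁻¹ := by noncomm_ring
        _ = 0 := by rw [← e, mul_zero, zero_mul]
    obtain ⟨q, hq, rfl⟩ : ∃ q ∈ φ.source, φ q = y := ⟨φ.symm y, φ.map_target hy, φ.right_inv hy⟩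
    obtain ⟨v', rfl⟩ := (mfderiv_chart_bijective p hq).2 v
    have hF0 : diff (𝓡 2) F q v' = 0 := (diff_eq_diffL hF.smooth p hq v').trans
      ((diffL_apply ((hsm _ hy).differentiableAt (by simp)) _).trans hd')
    have hv0 : v' = 0 := by
      apply hF.immersion q
      rw [hF0, diff_eq_diffL hF.smooth p hq, map_zero]
      exact (map_zero _).symm
    rw [hv0, map_zero]
    rfl
  obtain ⟨e, he₁, he₂, he₃, he₄, he₅⟩ := exists_openPartialHomeomorph (hΘs.and hinj) hmodel
  refine ⟨φ.trans e, ?_, ?_, ?_⟩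
  · refine OpenPartialHomeomorph.mem_maximalAtlas_of_contMDiffOn _ ?_ ?_
    · exact (contMDiffOn_iff_contDiffOn.mpr he₄).comp
        ((contMDiffOn_chart (x := p)).mono fun q hq => hq.1) fun q hq => hq.2
    · exact (contMDiffOn_chart_symm (x := p)).comp
        ((contMDiffOn_iff_contDiffOn.mpr he₅).mono fun y hy => hy.1) fun y hy => hy.2
  · exact ⟨hp, he₁⟩
  · intro q hq
    have hm : ψ' (φ q) = model (Θ (φ q) 0) (Θ (φ q) 1) := he₂ hq.2
    rw [OpenPartialHomeomorph.coe_trans, Function.comp_apply, he₃, ← hm]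
    simp only [hψ', hψ, φ.left_inv hq.1]

end Surface

end NKSL2

/-- Flatness is not needed: a totally geodesic negative definite surface whose tangent planes are
`J`-invariant is flat by the Gauss and Codazzi equations. -/
theorem proposition4p3 {M : Type*} [TopologicalSpace M] [ConnectedSpace M]
    [ChartedSpace NKSL2.Plane M] [IsManifold (𝓡 2) ∞ M]
    (F : M → NKSL2.SLxSL) (hF : NKSL2.IsAlmostComplexSurface F)
    (hneg : NKSL2.IsNegDefSurface F) (hflat : NKSL2.IsFlat F)
    (hgeo : NKSL2.IsTotallyGeodesic F) :
    ∃ a b c : SL(2, ℝ), NKSL2.IsIsometry (NKSL2.translation a b c) ∧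
      ∀ p : M, ∃ φ ∈ IsManifold.maximalAtlas (𝓡 2) ∞ M, p ∈ φ.source ∧
        ∀ q ∈ φ.source, NKSL2.translation a b c (F q) = NKSL2.model (φ q 0) (φ q 1) := by
  obtain ⟨a, b, c, h⟩ := NKSL2.exists_translation_commute hF hneg hgeo
  exact ⟨a, b, c, NKSL2.isIsometry_translation a b c, NKSL2.exists_coordinates hF h⟩
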